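/- Let $p,q,e$ be integers with $0<p<q$ and $\gcd(p,q)=1$, let $L=L(1/2,1/2,p/q;e)$ be the Montesinos link (rational tangles $1/2,1/2,p/q$ in cyclic order from left to right, together with $e$ right-handed half-twists, the sign convention being that $p/q\mapsto p/q\pm1$, $e\mapsto e\pm1$ does not change the link), and let $w=(e-1)q-p$. Let $Q_2(L)$ be the involutory quandle of $L$, given by the Wirtinger presentation of a diagram: one generator for each arc, and one relation $u\rhd o=v$ for each crossing with overstrand $o$ and understrand $u$, $v$. Let $1,2,3\in Q_2(L)$ be the elements given by the arcs at the lower left end of the first tangle $1/2$, the lower right end of the first tangle $1/2$, and the upper right end of the second tangle $1/2$ (which is the upper left end of the tangle $p/q$). Here each tangle $1/2$ is drawn as a vertical twist with two crossings, in which the overstrands at the two crossings belong to the arcs ending at the lower left and the upper right. The Cayley graph of $Q_2(L)$ has the elements of $Q_2(L)$ as vertices and, for every $x\in Q_2(L)$ and $i\in\{1,2,3\}$, an edge labeled $i$ joining $x$ and $x\rhd i$. Let $\mathcal C_i$ be its component containing $i$. Let $\mathcal T$ be the following labeled planar graph. The basic tile is the hexagon with vertices $(0,1),(0,3),(0,5),(1,5),(1,3),(1,1)$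 in cyclic order, consecutive ones being joined by an edge; $\mathcal T$ is the union of its translates by $(m,n)$, $m,n\in\mathbb Z$, $n\equiv 2m \pmod 4$. Horizontal edges are labeled $2$; a vertical edge with upper endpoint $(x,y)$ is labeled $3$ if $y\equiv3\pmod 4$ and $1$ if $y\equiv 1\pmod 4$. Let $\mathcal T_i$ be $\mathcal T$ with the vertex $(0,1)$ labeled by the generator $i$. Let $\rho_{(a,b)}$ be the rotation by $\pi$ about $(a,b)$, $\tau_{(a,b)}$ the translation by $(a,b)$, $\phi_c$ the reflection across the line $x=c$, and $\gamma_{(b,c)}=\tau_{(0,b)}\circ\phi_c$. Then, as labeled graphs (edge labels and the labeled vertex $i$ being respected): (a) If $q$ is odd, the Cayley graph of $Q_2(L)$ has exactly two components, $\mathcal C_1=\mathcal C_3$ and $\mathcal C_2$, and $$\mathcal C_1\cong\mathcal T_1/\langle\rho_{(0,0)},\rho_{(w,0)},\rho_{(0,2q)}\rangle,\qquad \mathcal C_2\cong\mathcal T_2/\langle\tau_{(0,4)},\phi_{1/2},\phi_{w+1/2}\rangle.$$ (b) If $q$ is even, the Cayley graph has exactly three components, $\mathcal C_1$, $\mathcal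 C_2$ and $\mathcal C_3$, and $$\mathcal C_1\cong\mathcal T_1/\langle\rho_{(0,0)},\rho_{(0,2q)},\gamma_{(2q,w/2)}\rangle,\qquad \mathcal C_2\cong\mathcal T_2/\langle\tau_{(0,4)},\phi_{1/2},\phi_{w+1/2}\rangle,$$ $$\mathcal C_3\cong\mathcal T_3/\langle\rho_{(0,2)},\rho_{(0,2+2q)},\gamma_{(2q,w/2)}\rangle,$$ and $\mathcal C_3$ is obtained from $\mathcal C_1$ by trading all labels $1$ and $3$ (of edges and of the labeled vertex). -/

import Mathlib

open Quandles

/-! ## Presented involutory quandles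

Mathlib's quandles act on the left: `x ◃ y` is the element written `y ▷ x = y ^ x`
in the exponential convention. -/

/-- Formal quandle expressions in generators from `A`; `act x y` stands for `x ◃ y`. -/
inductive QTerm (A : Type) : Type
  | gen (a : A) : QTerm A
  | act (x y : QTerm A) : QTerm A

/-- The smallest congruence on expressions which contains the relations `R` and the axioms of an
involutory quandle. -/
inductive QTerm.Rel {A : Type} (R : QTerm A → QTerm A → Prop) : QTerm A → QTerm A → Prop
  | of {x y : QTerm A} (h : R x y) : Rel R x y
  | refl (x : QTerm A) : Rel R x x
  | symm {x y : QTerm A} (h : Rel R x y) : Rel R y x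
  | trans {x y z : QTerm A} (h : Rel R x y) (h' : Rel R y z) : Rel R x z
  | congr {x x' y y' : QTerm A} (h : Rel R x x') (h' : Rel R y y') :
      Rel R (.act x y) (.act x' y')
  | idem (x : QTerm A) : Rel R (.act x x) x
  | invol (x y : QTerm A) : Rel R (.act x (.act x y)) y
  | distrib (x y z : QTerm A) :
      Rel R (.act x (.act y z)) (.act (.act x y) (.act x z))

/-- The congruence as a setoid. -/
def QTerm.setoid {A : Type} (R : QTerm A → QTerm A → Prop) : Setoid (QTerm A) where
  r := QTerm.Rel R
  iseqv := ⟨QTerm.Rel.refl, QTerm.Rel.symm, QTerm.Rel.trans⟩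

/-- The involutory quandle presented by the generators `A` and the relations `R`. -/
def InvQuandle {A : Type} (R : QTerm A → QTerm A → Prop) : Type :=
  Quotient (QTerm.setoid R)

namespace InvQuandle

variable {A : Type} {R : QTerm A → QTerm A → Prop}

/-- The element given by a generator. -/
def gen (R : QTerm A → QTerm A → Prop) (a : A) : InvQuandle R :=
  Quotient.mk (QTerm.setoid R) (.gen a)

/-- The quandle operation. -/
def op (x y : InvQuandle R) : InvQuandle R :=
  Quotient.map₂ QTerm.act (fun _ _ h _ _ h' => QTerm.Rel.congr h h') x y

instance : Quandle (InvQuandle R) where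
  act := op
  invAct := op
  self_distrib := by
    intro x y z
    induction x using Quotient.inductionOn
    induction y using Quotient.inductionOn
    induction z using Quotient.inductionOn
    exact Quotient.sound (QTerm.Rel.distrib _ _ _)
  left_inv := by
    intro x y
    induction x using Quotient.inductionOn
    induction y using Quotient.inductionOn
    exact Quotient.sound (QTerm.Rel.invol _ _)
  right_inv := by
    intro x y
    induction x using Quotient.inductionOn
    induction y using Quotient.inductionOn
    exact Quotient.sound (QTerm.Rel.invol _ _)
  fix := by
    intro x
    induction x using Quotient.inductionOn
    exact Quotient.sound (QTerm.Rel.idem _)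

theorem isInvolutory : Rack.IsInvolutory (InvQuandle R) := fun x y => Rack.left_inv x y

end InvQuandle

/-! ## Tangle and link diagrams -/

/-- The four corners at which the strands of a tangle diagram end. -/
inductive Corner : Type
  | nw
  | ne
  | sw
  | se

/-- Diagrams of (algebraic) tangles.
* `zero` is the tangle of two horizontal arcs, `infty` that of two vertical arcs;
* `pos` is the single crossing whose overstrand joins the corners `sw` and `ne`, and `neg` the
  single crossing whose overstrand joins the corners `nw` and `se`;
* `hsum S T` is `S` with `T` attached on its right;
* `vsum S T` is `S` with `T` attached below. -/
inductive Tangle : Type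
  | zero : Tangle
  | infty : Tangle
  | pos : Tangle
  | neg : Tangle
  | hsum (S T : Tangle) : Tangle
  | vsum (S T : Tangle) : Tangle

/-- What the Wirtinger presentation needs to know about a tangle diagram: the labels that are put
on the diagram, the label at each corner, which labels belong to one and the same arc
(`same a b`), and the crossings (`crossing o u v`: at some crossing the overstrand has label `o`,
and `u`, `v` are the labels of the understrand on its two sides). -/
structure WirtingerData : Type 1 where
  Arc : Type
  corner : Corner → Arc
  same : Arc → Arc → Prop
  crossing : Arc → Arc → Arc → Prop

namespace WirtingerData

/-- Two diagrams put side by side without overlap, with prescribed corners, whose labels are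
moreover identified according to `glue`. -/
def join (D E : WirtingerData) (c : Corner → D.Arc ⊕ E.Arc) (glue : D.Arc → E.Arc → Prop) :
    WirtingerData where
  Arc := D.Arc ⊕ E.Arc
  corner := c
  same := fun
    | .inl a, .inl b => D.same a b
    | .inr a, .inr b => E.same a b
    | .inl a, .inr b => glue a b
    | .inr _, .inl _ => False
  crossing := fun
    | .inl o, .inl u, .inl v => D.crossing o u v
    | .inr o, .inr u, .inr v => E.crossing o u v
    | _, _, _ => False

end WirtingerData

/-- The Wirtinger data of a tangle diagram: every elementary piece carries a label at each of its
four corners, and labels which meet when pieces are attached are identified. -/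
def Tangle.data : Tangle → WirtingerData
  | .zero =>
    { Arc := Corner
      corner := id
      same := fun a b => (a = .nw ∧ b = .ne) ∨ (a = .sw ∧ b = .se)
      crossing := fun _ _ _ => False }
  | .infty =>
    { Arc := Corner
      corner := id
      same := fun a b => (a = .nw ∧ b = .sw) ∨ (a = .ne ∧ b = .se)
      crossing := fun _ _ _ => False }
  | .pos =>
    { Arc := Corner
      corner := id
      same := fun a b => a = .sw ∧ b = .ne
      crossing := fun o u v => o = .sw ∧ u = .nw ∧ v = .se }
  | .neg =>
    { Arc := Corner
      corner := id
      same := fun a b => a = .nw ∧ b = .se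
      crossing := fun o u v => o = .nw ∧ u = .sw ∧ v = .ne }
  | .hsum S T => S.data.join T.data
      (fun
        | .nw => .inl (S.data.corner .nw)
        | .sw => .inl (S.data.corner .sw)
        | .ne => .inr (T.data.corner .ne)
        | .se => .inr (T.data.corner .se))
      (fun a b => (a = S.data.corner .ne ∧ b = T.data.corner .nw) ∨
        (a = S.data.corner .se ∧ b = T.data.corner .sw))
  | .vsum S T => S.data.join T.data
      (fun
        | .nw => .inl (S.data.corner .nw)
        | .ne => .inl (S.data.corner .ne)
        | .sw => .inr (T.data.corner .sw)
        | .se => .inr (T.data.corner .se))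
      (fun a b => (a = S.data.corner .sw ∧ b = T.data.corner .nw) ∨
        (a = S.data.corner .se ∧ b = T.data.corner .ne))

/-- `Tangle.Twist T a b`: the diagram `T` arises from `zero` or `infty` by successively adding
single crossings at any of the four sides, and its fraction, computed by the usual rules, is
`a / b` (where `1 / 0` is the fraction of `infty`): a crossing `pos` (resp. `neg`) at the right or
left changes the fraction `F` to `F + 1` (resp. `F - 1`), and at the top or bottom it changes
`1 / F` to `1 / F + 1` (resp. `1 / F - 1`). -/
inductive Tangle.Twist : Tangle → ℤ → ℤ → Prop
  | zero : Twist .zero 0 1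
  | infty : Twist .infty 1 0
  | right_pos {T : Tangle} {a b : ℤ} (h : Twist T a b) : Twist (.hsum T .pos) (a + b) b
  | right_neg {T : Tangle} {a b : ℤ} (h : Twist T a b) : Twist (.hsum T .neg) (a - b) b
  | left_pos {T : Tangle} {a b : ℤ} (h : Twist T a b) : Twist (.hsum .pos T) (a + b) b
  | left_neg {T : Tangle} {a b : ℤ} (h : Twist T a b) : Twist (.hsum .neg T) (a - b) b
  | bottom_pos {T : Tangle} {a b : ℤ} (h : Twist T a b) : Twist (.vsum T .pos) a (b + a)
  | bottom_neg {T : Tangle} {a b : ℤ} (h : Twist T a b) : Twist (.vsum T .neg) a (b - a)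
  | top_pos {T : Tangle} {a b : ℤ} (h : Twist T a b) : Twist (.vsum .pos T) a (b + a)
  | top_neg {T : Tangle} {a b : ℤ} (h : Twist T a b) : Twist (.vsum .neg T) a (b - a)

/-- `T` is a diagram of the rational tangle with (finite) fraction `r`. -/
def Tangle.IsRational (T : Tangle) (r : ℚ) : Prop :=
  ∃ a b : ℤ, T.Twist a b ∧ b ≠ 0 ∧ (a : ℚ) / b = r

/-- The standard diagram of the rational tangle `1/2`: a vertical twist with two crossings. -/
def Tangle.half : Tangle := .vsum .pos .pos

/-- A horizontal row of `n` copies of the crossing `c`. -/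
def Tangle.row (c : Tangle) : ℕ → Tangle
  | 0 => .zero
  | n + 1 => .hsum (Tangle.row c n) c

/-- `e` right-handed horizontal half-twists (left-handed ones if `e < 0`). -/
def Tangle.halfTwists : ℤ → Tangle
  | .ofNat n => Tangle.row .neg n
  | .negSucc n => Tangle.row .pos (n + 1)

/-- The tangle diagram whose closure is the Montesinos link of the three tangles and `e`. -/
def Tangle.montesinos (T₁ T₂ T₃ : Tangle) (e : ℤ) : Tangle :=
  .hsum T₁ (.hsum T₂ (.hsum T₃ (Tangle.halfTwists e)))

/-- The Wirtinger relations of the link diagram obtained from a tangle diagram by joining its two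
upper ends and its two lower ends by arcs that run around the diagram. -/
inductive Tangle.ClosureRel (T : Tangle) : QTerm T.data.Arc → QTerm T.data.Arc → Prop
  | same {a b : T.data.Arc} (h : T.data.same a b) : ClosureRel T (.gen a) (.gen b)
  | upper : ClosureRel T (.gen (T.data.corner .ne)) (.gen (T.data.corner .nw))
  | lower : ClosureRel T (.gen (T.data.corner .se)) (.gen (T.data.corner .sw))
  | crossing {o u v : T.data.Arc} (h : T.data.crossing o u v) :
      ClosureRel T (.act (.gen o) (.gen u)) (.gen v)

/-- The involutory quandle `Q₂(L)` of the link `L` which is the closure of the tangle diagram. -/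
abbrev Tangle.Q₂ (T : Tangle) : Type := InvQuandle T.ClosureRel

/-! ## The link `L(1/2, 1/2, p/q; e)` and the generators `1`, `2`, `3` -/

/-- The three generators; also the labels of the edges of Cayley graphs. -/
inductive Gen : Type
  | one
  | two
  | three
  deriving DecidableEq

/-- The diagram of `L(1/2, 1/2, p/q; e)` in which the rational tangle `p/q` is drawn as `T`. -/
def linkDiagram (T : Tangle) (e : ℤ) : Tangle := Tangle.montesinos Tangle.half Tangle.half T e

/-- The arcs labelled by the generators: `1` is the arc at the lower left end of the first tangle,
`2` the arc at the lower right end of the first (and lower left end of the second) tangle, and `3`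
the arc at the upper right end of the second (and upper left end of the third) tangle. -/
def genArc (T : Tangle) (e : ℤ) : Gen → (linkDiagram T e).data.Arc
  | .one => .inl (Tangle.half.data.corner .sw)
  | .two => .inl (Tangle.half.data.corner .se)
  | .three => .inr (.inl (Tangle.half.data.corner .ne))

/-- The generators as elements of the involutory quandle of the link. -/
def linkGen (T : Tangle) (e : ℤ) (i : Gen) : (linkDiagram T e).Q₂ :=
  InvQuandle.gen _ (genArc T e i)

/-! ## Graphs with labelled edges -/

/-- Undirected graphs, loops allowed, with edges labelled by `Λ`: `Adj l u v` means that there is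
an edge labelled `l` between `u` and `v`. -/
structure LabeledGraph (Λ : Type) : Type 1 where
  V : Type
  Adj : Λ → V → V → Prop
  symm : ∀ l u v, Adj l u v → Adj l v u

namespace LabeledGraph

variable {Λ : Type}

/-- The vertex set of the connected component of `v`. -/
def component (G : LabeledGraph Λ) (v : G.V) : Set G.V :=
  {u | Relation.ReflTransGen (fun a b => ∃ l, G.Adj l a b) v u}

/-- The set of all connected components. -/
def components (G : LabeledGraph Λ) : Set (Set G.V) := Set.range G.component

/-- The component of `v` as a graph. -/
def componentGraph (G : LabeledGraph Λ) (v : G.V) : LabeledGraph Λ where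
  V := G.component v
  Adj := fun l a b => G.Adj l a.1 b.1
  symm := fun l a b h => G.symm l a.1 b.1 h

/-- The vertex `v` of its own component. -/
def base (G : LabeledGraph Λ) (v : G.V) : (G.componentGraph v).V :=
  ⟨v, Relation.ReflTransGen.refl⟩

/-- The quotient graph: vertices and edges are the classes of vertices and edges. -/
def quotient (G : LabeledGraph Λ) (r : Setoid G.V) : LabeledGraph Λ where
  V := Quotient r
  Adj := fun l a b => ∃ u v : G.V, Quotient.mk r u = a ∧ Quotient.mk r v = b ∧ G.Adj l u v
  symm := by
    rintro l a b ⟨u, v, hu, hv, h⟩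
    exact ⟨v, u, hv, hu, G.symm l u v h⟩

/-- The same graph with the edge labels changed by a permutation of the labels. -/
def relabel (G : LabeledGraph Λ) (σ : Equiv.Perm Λ) : LabeledGraph Λ where
  V := G.V
  Adj := fun l u v => G.Adj (σ.symm l) u v
  symm := fun l u v h => G.symm (σ.symm l) u v h

/-- There is an isomorphism of labelled graphs from `G` to `H` taking the vertex `a` to `b`. -/
def PointedIso (G : LabeledGraph Λ) (a : G.V) (H : LabeledGraph Λ) (b : H.V) : Prop :=
  ∃ f : G.V ≃ H.V, (∀ l u v, G.Adj l u v ↔ H.Adj l (f u) (f v)) ∧ f a = b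

end LabeledGraph

/-- The Cayley graph of `Q₂(L)` with respect to the generators `1`, `2`, `3`: an edge labelled `i`
joins `x` and `x ▷ i` for all `x` and `i`. -/
def cayleyGraph (T : Tangle) (e : ℤ) : LabeledGraph Gen where
  V := (linkDiagram T e).Q₂
  Adj := fun i x y => linkGen T e i ◃ x = y
  symm := by
    rintro i x _ rfl
    exact Rack.left_inv (linkGen T e i) x

/-! ## The tile graph and its symmetries -/

/-- The six vertices of the basic tile. -/
def tileVertices : Set (ℤ × ℤ) := {(0, 1), (0, 3), (0, 5), (1, 5), (1, 3), (1, 1)}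

/-- The six edges of the basic tile. -/
def tileEdges : Set (Sym2 (ℤ × ℤ)) :=
  {s((0, 1), (0, 3)), s((0, 3), (0, 5)), s((0, 5), (1, 5)), s((1, 5), (1, 3)),
    s((1, 3), (1, 1)), s((1, 1), (0, 1))}

/-- The translates of the basic tile by `(m, n)` with `n ≡ 2 m (mod 4)` make up the graph. -/
def IsTileVertex (v : ℤ × ℤ) : Prop :=
  ∃ m n : ℤ, n ≡ 2 * m [ZMOD 4] ∧ v - (m, n) ∈ tileVertices

/-- Adjacency in the union of the translates. -/
def IsTileEdge (u v : ℤ × ℤ) : Prop :=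
  ∃ m n : ℤ, n ≡ 2 * m [ZMOD 4] ∧ s(u - (m, n), v - (m, n)) ∈ tileEdges

/-- The label of the edge between `u` and `v`: horizontal edges are labelled `2`, and vertical
edges with upper end `(x, y)` are labelled `3` if `y ≡ 3` and `1` if `y ≡ 1` (mod 4). -/
def HasTileLabel : Gen → ℤ × ℤ → ℤ × ℤ → Prop
  | .one, u, v => u.1 = v.1 ∧ max u.2 v.2 ≡ 1 [ZMOD 4]
  | .two, u, v => u.2 = v.2
  | .three, u, v => u.1 = v.1 ∧ max u.2 v.2 ≡ 3 [ZMOD 4]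

/-- The labelled planar graph `𝒯`. -/
def tileGraph : LabeledGraph Gen where
  V := {v : ℤ × ℤ // IsTileVertex v}
  Adj := fun l u v => IsTileEdge u.1 v.1 ∧ HasTileLabel l u.1 v.1
  symm := by
    rintro l u v ⟨⟨m, n, h, h'⟩, hl⟩
    refine ⟨⟨m, n, h, by rwa [Sym2.eq_swap]⟩, ?_⟩
    cases l
    · exact ⟨hl.1.symm, by rw [max_comm]; exact hl.2⟩
    · exact Eq.symm hl
    · exact ⟨hl.1.symm, by rw [max_comm]; exact hl.2⟩

/-- The vertex `(0, 1)` of `𝒯`. -/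
def tileBase : tileGraph.V := ⟨(0, 1), 0, 0, rfl, by simp [tileVertices]⟩

/-- The rotation by `π` about the point `(a, b)`. -/
def tileRot (a b : ℤ) : Equiv.Perm (ℤ × ℤ) where
  toFun v := (2 * a - v.1, 2 * b - v.2)
  invFun v := (2 * a - v.1, 2 * b - v.2)
  left_inv v := by ext <;> simp
  right_inv v := by ext <;> simp

/-- The translation by `(a, b)`. -/
def tileTrans (a b : ℤ) : Equiv.Perm (ℤ × ℤ) := Equiv.addRight (a, b)

/-- The reflection across the vertical line `x = k / 2`. -/
def tileRefl (k : ℤ) : Equiv.Perm (ℤ × ℤ) where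
  toFun v := (k - v.1, v.2)
  invFun v := (k - v.1, v.2)
  left_inv v := by ext <;> simp
  right_inv v := by ext <;> simp

/-- The glide reflection: reflection across `x = k / 2` followed by translation by `(0, b)`. -/
def tileGlide (b k : ℤ) : Equiv.Perm (ℤ × ℤ) := tileTrans 0 b * tileRefl k

/-- Two vertices of `𝒯` are equivalent if some element of the group `Γ` moves one to the other. -/
def tileSetoid (Γ : Subgroup (Equiv.Perm (ℤ × ℤ))) : Setoid tileGraph.V where
  r u v := ∃ g ∈ Γ, g u.1 = v.1
  iseqv :=
    { refl := fun _ => ⟨1, Γ.one_mem, rfl⟩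
      symm := by
        rintro u v ⟨g, hg, h⟩
        exact ⟨g⁻¹, Γ.inv_mem hg, by rw [← h]; simp⟩
      trans := by
        rintro u v x ⟨g, hg, h⟩ ⟨k, hk, h'⟩
        exact ⟨k * g, Γ.mul_mem hk hg, by rw [← h', ← h]; rfl⟩ }

/-- The quotient of `𝒯` by the group generated by `S`. -/
def tileQuotient (S : Set (Equiv.Perm (ℤ × ℤ))) : LabeledGraph Gen :=
  tileGraph.quotient (tileSetoid (Subgroup.closure S))

/-- The class of the vertex `(0, 1)`. -/
def tileQuotientBase (S : Set (Equiv.Perm (ℤ × ℤ))) : (tileQuotient S).V :=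
  Quotient.mk (tileSetoid (Subgroup.closure S)) tileBase

/-- The component of the generator `i` in the Cayley graph is the quotient, by the group generated
by `S`, of the tile graph with the vertex `(0, 1)` labelled by the generator `i`. -/
def ComponentIsTileQuotient (T : Tangle) (e : ℤ) (i : Gen) (S : Set (Equiv.Perm (ℤ × ℤ))) : Prop :=
  ((cayleyGraph T e).componentGraph (linkGen T e i)).PointedIso
    ((cayleyGraph T e).base (linkGen T e i)) (tileQuotient S) (tileQuotientBase S)

/-! ## Homomorphisms from the infinite dihedral quandle -/

/-! Write s₁, s₂, s₃ for the actions of the generators. The arc joining the tops of the two tangles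
1/2 equals both x₁ ◃ x₂ and x₃ ◃ x₂. Hence s₁s₂s₁ = s₃s₂s₃, that is, s₃s₁ commutes with s₂. This
makes the quandle planar (`exists_isCoordinates`): there are elements a(x,m), multiplying like the
rotations by π about lattice points, and b(n), multiplying like the reflections across the lines of
abscissa n + 1/2, with x₁ = a(0,0), x₃ = a(0,1), x₂ = b(0).

A colouring of a rational tangle is a homomorphism f from the infinite dihedral quandle ℤ, with
colours f(0), f(p), f(q), f(p+q) at the corners (`Tangle.Twist.exists_isUniversal`). Matching the
ends of p/q and of the e half-twists with the rest of the diagram gives f(qi - wj) = a(i, 1-j). So a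
has the period (w,-q), by reflection also (w,q), and b has the period 2w. Since q and w are coprime,
every f(n) is some a(x,m), so the a's and b's exhaust the quandle. There are no further
identifications, because the rotations and reflections modulo these periods satisfy all Wirtinger
relations (`exists_map_link_model`).

Each hexagon of 𝒯 spells out the relation that s₂ commutes with s₃s₁ (or its inverse), and each
vertex has exactly one edge of each label. So there are maps from 𝒯 to the quandle which turn steps
along edges into actions (`rotOrbit`, `reflOrbit`). Each component is 𝒯 modulo the fibres of such a
map (`componentIsTileQuotient_of_kernel`), and the fibres are the orbits of the stated groups: the
point symmetry of the base element together with the periods. The parity of m is preserved by the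
actions; it is an invariant of the element a(x,m) precisely when q is even, and this separates the
cases. -/

theorem Rack.IsInvolutory.act'_mul_self {X : Type} [Rack X] (hX : Rack.IsInvolutory X) (x : X) :
    Rack.act' x * Rack.act' x = 1 := by
  ext y
  exact hX x y

theorem Rack.IsInvolutory.act'_inv {X : Type} [Rack X] (hX : Rack.IsInvolutory X) (x : X) :
    (Rack.act' x)⁻¹ = Rack.act' x :=
  inv_eq_of_mul_eq_one_left (hX.act'_mul_self x)

/-- `f` is a homomorphism from the infinite dihedral quandle, that is, from `ℤ` with the operation
`i ◃ j = 2 i - j`. -/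
def IsDihedralHom {X : Type} [Quandle X] (f : ℤ → X) : Prop :=
  ∀ i j, f i ◃ f j = f (2 * i - j)

namespace IsDihedralHom

variable {X : Type} [Quandle X] {f g : ℤ → X}

theorem act_eq (hf : IsDihedralHom f) {x y : X} {i j : ℤ} (hx : x = f i) (hy : y = f j) :
    x ◃ y = f (2 * i - j) := by
  rw [hx, hy, hf]

theorem comp_affine (hf : IsDihedralHom f) (c d : ℤ) : IsDihedralHom fun k => f (c + d * k) := by
  intro i j
  rw [hf]
  ring_nf

/-- Two consecutive values determine a homomorphism, because f (k + 1) = f k ◃ f (k - 1) and f (k -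
1) = f k ◃ f (k + 1). -/
theorem ext_of_eq (hf : IsDihedralHom f) (hg : IsDihedralHom g) (c : ℤ) (h0 : f c = g c)
    (h1 : f (c + 1) = g (c + 1)) (k : ℤ) : f k = g k := by
  have key : ∀ n : ℕ, (f (c + n) = g (c + n) ∧ f (c + n + 1) = g (c + n + 1)) ∧
      (f (c - n) = g (c - n) ∧ f (c - n + 1) = g (c - n + 1)) := by
    intro n
    induction n with
    | zero => simp [h0, h1]
    | succ n ih =>
      obtain ⟨⟨h2, h3⟩, h4, h5⟩ := ih
      refine ⟨⟨?_, ?_⟩, ?_, ?_⟩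
      · push_cast
        rwa [← add_assoc]
      · have := hf (c + n + 1) (c + n)
        rw [h2, h3, hg] at this
        push_cast
        convert this.symm using 2 <;> ring
      · have := hf (c - n) (c - n + 1)
        rw [h4, h5, hg] at this
        push_cast
        convert this.symm using 2 <;> ring
      · push_cast
        convert h4 using 2 <;> ring
  rcases le_total c k with h | h
  · have := (key (k - c).toNat).1.1
    rwa [Int.toNat_of_nonneg (by omega), add_sub_cancel] at this
  · have := (key (c - k).toNat).2.1
    rwa [Int.toNat_of_nonneg (by omega), sub_sub_cancel] at this

end IsDihedralHom

/-- The infinite dihedral quandle is the free involutory quandle on `0` and `1`. -/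
theorem exists_isDihedralHom {X : Type} [Quandle X] (hX : Rack.IsInvolutory X) (x y : X) :
    ∃ f : ℤ → X, IsDihedralHom f ∧ f 0 = x ∧ f 1 = y := by
  set s : Equiv.Perm X := Rack.act' x with hs
  set r : Equiv.Perm X := Rack.act' y with hr
  set t : Equiv.Perm X := r * s with ht
  have hss : s⁻¹ = s := hX.act'_inv x
  have hrr : r⁻¹ = r := hX.act'_inv y
  have hst : ∀ n : ℤ, s * t ^ n = t ^ (-n) * s := by
    intro n
    have : s * t * s⁻¹ = t⁻¹ := by rw [ht, mul_inv_rev, hss, hrr]; nth_rw 3 [← hss]; group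
    have h2 : s * t ^ n * s⁻¹ = t ^ (-n) := by rw [← conj_zpow, this, inv_zpow, zpow_neg]
    rw [← h2]; group
  -- Forced by f (k + 2) = f (k + 1) ◃ (f k ◃ f k) and its conjugates: shifting by 2 is t. Floor
  -- division makes this right for negative k too.
  let f : ℤ → X := fun k => (t ^ (k / 2)) (if k % 2 = 0 then x else y)
  have f0 : ∀ n, f (2 * n) = (t ^ n) x := by
    intro n
    have h1 : 2 * n / 2 = n := by omega
    have h2 : 2 * n % 2 = 0 := by omega
    simp only [f, h1, h2, if_true]
  have f1 : ∀ n, f (2 * n + 1) = (t ^ n) y := by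
    intro n
    have h1 : (2 * n + 1) / 2 = n := by omega
    have h2 : ¬ (2 * n + 1) % 2 = 0 := by omega
    simp only [f, h1, h2, if_false]
  have hconj : ∀ (n : ℤ) (z : X), Rack.act' ((t ^ n) z) = t ^ n * Rack.act' z * (t ^ n)⁻¹ := by
    have one : ∀ z, Rack.act' (t z) = t * Rack.act' z * t⁻¹ := by
      intro z
      change Rack.act' (y ◃ (x ◃ z)) = _
      rw [Rack.ad_conj, Rack.ad_conj, ht, mul_inv_rev]
      simp only [mul_assoc]; rfl
    intro n
    induction n using Int.induction_on with
    | zero => intro z; simp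
    | succ n ih =>
      intro z
      rw [zpow_add_one, Equiv.Perm.mul_apply, ih, one]
      group
    | pred n ih =>
      intro z
      have := one (t⁻¹ z)
      rw [← Equiv.Perm.mul_apply, mul_inv_cancel, Equiv.Perm.one_apply] at this
      rw [zpow_sub_one, Equiv.Perm.mul_apply, ih, this]
      group
  -- All values of f act as reflections t ^ k * s of one dihedral group, so the homomorphism law
  -- reduces to a computation there.
  have hact : ∀ k, Rack.act' (f k) = t ^ k * s := by
    intro k
    rcases Int.even_or_odd' k with ⟨n, rfl | rfl⟩
    · rw [f0, hconj, ← hs, ← zpow_neg, mul_assoc, hst, neg_neg, ← mul_assoc, ← zpow_add, two_mul]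
    · have : r = t * s := by
        rw [ht, mul_assoc, ← sq, sq, hX.act'_mul_self, mul_one]
      rw [f1, hconj, ← hr, this, ← zpow_neg, mul_assoc, mul_assoc, hst, neg_neg, ← mul_assoc,
        ← mul_assoc, ← zpow_add_one, ← zpow_add]
      congr 2; ring
  refine ⟨f, ?_, by simpa using f0 0, by simpa using f1 0⟩
  intro i j
  rw [← Rack.act'_apply, hact]
  have hsx : s x = x := Quandle.fix
  have hsy : s y = t⁻¹ y := by
    rw [ht, mul_inv_rev, hss, hrr, Equiv.Perm.mul_apply]
    congr 1
    exact (Quandle.fix (x := y)).symm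
  rcases Int.even_or_odd' j with ⟨n, rfl | rfl⟩
  · rw [f0, ← Equiv.Perm.mul_apply, mul_assoc, hst, ← mul_assoc, ← zpow_add, Equiv.Perm.mul_apply,
      hsx, ← sub_eq_add_neg, ← f0]
    congr 1; ring
  · rw [f1, ← Equiv.Perm.mul_apply, mul_assoc, hst, ← mul_assoc, ← zpow_add, Equiv.Perm.mul_apply,
      hsy, ← Equiv.Perm.mul_apply, ← zpow_sub_one, ← f1]
    congr 1; ring

/-! ## Colourings of tangle diagrams -/

/-- `c` colours the diagram by `X`, where the Wirtinger relations for the operation `op` hold up to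
the relation `r`. -/
def IsColoring {X : Type} (op : X → X → X) (r : X → X → Prop) (D : WirtingerData) (c : D.Arc → X) :
    Prop :=
  (∀ a b, D.same a b → r (c a) (c b)) ∧ ∀ o u v, D.crossing o u v → r (op (c o) (c u)) (c v)

namespace IsColoring

variable {X : Type} {op : X → X → X} {r : X → X → Prop}

theorem zero_iff {c : Corner → X} : IsColoring op r Tangle.zero.data c ↔
    r (c .nw) (c .ne) ∧ r (c .sw) (c .se) := by
  constructor
  · rintro ⟨h, -⟩
    exact ⟨h _ _ (.inl ⟨rfl, rfl⟩), h _ _ (.inr ⟨rfl, rfl⟩)⟩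
  · rintro ⟨h1, h2⟩
    refine ⟨?_, fun _ _ _ h => h.elim⟩
    rintro a b (⟨rfl, rfl⟩ | ⟨rfl, rfl⟩)
    exacts [h1, h2]

theorem infty_iff {c : Corner → X} : IsColoring op r Tangle.infty.data c ↔
    r (c .nw) (c .sw) ∧ r (c .ne) (c .se) := by
  constructor
  · rintro ⟨h, -⟩
    exact ⟨h _ _ (.inl ⟨rfl, rfl⟩), h _ _ (.inr ⟨rfl, rfl⟩)⟩
  · rintro ⟨h1, h2⟩
    refine ⟨?_, fun _ _ _ h => h.elim⟩
    rintro a b (⟨rfl, rfl⟩ | ⟨rfl, rfl⟩)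
    exacts [h1, h2]

theorem pos_iff {c : Corner → X} : IsColoring op r Tangle.pos.data c ↔
    r (c .sw) (c .ne) ∧ r (op (c .sw) (c .nw)) (c .se) := by
  constructor
  · rintro ⟨h, h'⟩
    exact ⟨h _ _ ⟨rfl, rfl⟩, h' _ _ _ ⟨rfl, rfl, rfl⟩⟩
  · rintro ⟨h1, h2⟩
    refine ⟨?_, ?_⟩
    · rintro a b ⟨rfl, rfl⟩
      exact h1
    · rintro o u v ⟨rfl, rfl, rfl⟩
      exact h2

theorem neg_iff {c : Corner → X} : IsColoring op r Tangle.neg.data c ↔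
    r (c .nw) (c .se) ∧ r (op (c .nw) (c .sw)) (c .ne) := by
  constructor
  · rintro ⟨h, h'⟩
    exact ⟨h _ _ ⟨rfl, rfl⟩, h' _ _ _ ⟨rfl, rfl, rfl⟩⟩
  · rintro ⟨h1, h2⟩
    refine ⟨?_, ?_⟩
    · rintro a b ⟨rfl, rfl⟩
      exact h1
    · rintro o u v ⟨rfl, rfl, rfl⟩
      exact h2

theorem join_iff {D E : WirtingerData} {k : Corner → D.Arc ⊕ E.Arc} {glue : D.Arc → E.Arc → Prop}
    {c : D.Arc ⊕ E.Arc → X} : IsColoring op r (D.join E k glue) c ↔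
      IsColoring op r D (fun a => c (.inl a)) ∧ IsColoring op r E (fun a => c (.inr a)) ∧
        ∀ a b, glue a b → r (c (.inl a)) (c (.inr b)) := by
  constructor
  · rintro ⟨h, h'⟩
    exact ⟨⟨fun a b => h (.inl a) (.inl b), fun o u v => h' (.inl o) (.inl u) (.inl v)⟩,
      ⟨fun a b => h (.inr a) (.inr b), fun o u v => h' (.inr o) (.inr u) (.inr v)⟩,
      fun a b => h (.inl a) (.inr b)⟩
  · rintro ⟨⟨h1, h2⟩, ⟨h3, h4⟩, h5⟩
    refine ⟨?_, ?_⟩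
    · rintro (a | a) (b | b)
      exacts [h1 a b, h5 a b, False.elim, h3 a b]
    · rintro (o | o) (u | u) (v | v)
      exacts [h2 o u v, False.elim, False.elim, False.elim, False.elim, False.elim, False.elim,
        h4 o u v]

theorem hsum_iff {S T : Tangle} {c : S.data.Arc ⊕ T.data.Arc → X} :
    IsColoring op r (Tangle.hsum S T).data c ↔
      IsColoring op r S.data (fun a => c (.inl a)) ∧ IsColoring op r T.data (fun a => c (.inr a)) ∧
        r (c (.inl (S.data.corner .ne))) (c (.inr (T.data.corner .nw))) ∧
        r (c (.inl (S.data.corner .se))) (c (.inr (T.data.corner .sw))) := by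
  refine join_iff.trans (and_congr_right fun _ => and_congr_right fun _ => ⟨fun h =>
    ⟨h _ _ (.inl ⟨rfl, rfl⟩), h _ _ (.inr ⟨rfl, rfl⟩)⟩, ?_⟩)
  rintro ⟨h1, h2⟩ a b (⟨rfl, rfl⟩ | ⟨rfl, rfl⟩)
  exacts [h1, h2]

theorem vsum_iff {S T : Tangle} {c : S.data.Arc ⊕ T.data.Arc → X} :
    IsColoring op r (Tangle.vsum S T).data c ↔
      IsColoring op r S.data (fun a => c (.inl a)) ∧ IsColoring op r T.data (fun a => c (.inr a)) ∧
        r (c (.inl (S.data.corner .sw))) (c (.inr (T.data.corner .nw))) ∧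
        r (c (.inl (S.data.corner .se))) (c (.inr (T.data.corner .ne))) := by
  refine join_iff.trans (and_congr_right fun _ => and_congr_right fun _ => ⟨fun h =>
    ⟨h _ _ (.inl ⟨rfl, rfl⟩), h _ _ (.inr ⟨rfl, rfl⟩)⟩, ?_⟩)
  rintro ⟨h1, h2⟩ a b (⟨rfl, rfl⟩ | ⟨rfl, rfl⟩)
  exacts [h1, h2]

end IsColoring

/-! ## Colourings of rational tangles -/

/-- `lam` is a universal colouring of the tangle: every colouring by an involutory quandle is the
image of `lam` under a homomorphism from the infinite dihedral quandle. -/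
structure Tangle.IsUniversal (T : Tangle) (lam : T.data.Arc → ℤ) : Prop where
  isColoring : IsColoring (fun x y => 2 * x - y) Eq T.data lam
  exists_hom : ∀ (X : Type) [Quandle X], Rack.IsInvolutory X → ∀ c : T.data.Arc → X,
    IsColoring (fun x y => x ◃ y) Eq T.data c → ∃ f : ℤ → X, IsDihedralHom f ∧ ∀ x, c x = f (lam x)

theorem Rack.IsInvolutory.eq_act {X : Type} [Rack X] (hX : Rack.IsInvolutory X) {x y z : X}
    (h : x ◃ y = z) : y = x ◃ z := by
  rw [← h, hX]

/-- The corner colours of a tangle with fraction `a / b`. -/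
structure Tangle.HasSlope (T : Tangle) (lam : T.data.Arc → ℤ) (a b : ℤ) : Prop where
  ne : lam (T.data.corner .ne) = lam (T.data.corner .nw) - a
  sw : lam (T.data.corner .sw) = lam (T.data.corner .nw) - b
  se : lam (T.data.corner .se) = lam (T.data.corner .nw) - a - b

/-- Induction on the twists. A new crossing meets two old ends; one of its two new ends continues
the overstrand, and the colour of the other is the reflection of one old colour in the other. If the
understrand relation is given in the opposite direction, it is inverted by involutivity. Hence f is
unchanged, and only the corner colours have to be updated. -/
theorem Tangle.Twist.exists_isUniversal {T : Tangle} {a b : ℤ} (h : T.Twist a b) :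
    ∃ lam, T.IsUniversal lam ∧ T.HasSlope lam a b := by
  induction h with
  | zero =>
    refine ⟨fun | .nw => 0 | .ne => 0 | .sw => -1 | .se => -1, ⟨IsColoring.zero_iff.2 ⟨rfl, rfl⟩, ?_⟩,
      ⟨rfl, rfl, rfl⟩⟩
    intro X _ hX c hc
    obtain ⟨h1, h2⟩ := IsColoring.zero_iff.1 hc
    obtain ⟨f, hf, f0, f1⟩ := exists_isDihedralHom hX (c .nw) (c .sw)
    -- The corners carry 0 and -1, whereas `f` was prescribed at 0 and 1.
    refine ⟨_, hf.comp_affine 0 (-1), ?_⟩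
    rintro (_ | _ | _ | _) <;> simp [f0, f1, h1, h2]
  | infty =>
    refine ⟨fun | .nw => 0 | .ne => -1 | .sw => 0 | .se => -1,
      ⟨IsColoring.infty_iff.2 ⟨rfl, rfl⟩, ?_⟩, ⟨rfl, rfl, rfl⟩⟩
    intro X _ hX c hc
    obtain ⟨h1, h2⟩ := IsColoring.infty_iff.1 hc
    obtain ⟨f, hf, f0, f1⟩ := exists_isDihedralHom hX (c .nw) (c .ne)
    refine ⟨_, hf.comp_affine 0 (-1), ?_⟩
    rintro (_ | _ | _ | _) <;> simp [f0, f1, h1, h2]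
  | @right_pos T a b _ ih =>
    obtain ⟨lam, ⟨hl, hu⟩, ⟨h1, h2, h3⟩⟩ := ih
    refine ⟨Sum.elim lam fun
      | .nw => lam (T.data.corner .ne)
      | .sw => lam (T.data.corner .se)
      | .ne => lam (T.data.corner .se)
      | .se => 2 * lam (T.data.corner .se) - lam (T.data.corner .ne),
      ⟨IsColoring.hsum_iff.2 ⟨hl, IsColoring.pos_iff.2 ⟨rfl, rfl⟩, rfl, rfl⟩, ?_⟩, ⟨?_, ?_, ?_⟩⟩
    · intro X _ hX c hc
      obtain ⟨hc1, hc2, e1, e2⟩ := IsColoring.hsum_iff.1 hc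
      obtain ⟨e3, e4⟩ := IsColoring.pos_iff.1 hc2
      obtain ⟨f, hf, hcf⟩ := hu X hX _ hc1
      rw [hcf] at e1 e2
      refine ⟨f, hf, ?_⟩
      rintro (x | _ | _ | _ | _)
      · exact hcf x
      · exact e1.symm
      · exact e3.symm.trans e2.symm
      · exact e2.symm
      · exact e4.symm.trans (hf.act_eq e2.symm e1.symm)
    · change lam (T.data.corner .se) = lam (T.data.corner .nw) - (a + b)
      omega
    · exact h2
    · change 2 * lam (T.data.corner .se) - lam (T.data.corner .ne) =
        lam (T.data.corner .nw) - (a + b) - b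
      omega
  | @right_neg T a b _ ih =>
    obtain ⟨lam, ⟨hl, hu⟩, ⟨h1, h2, h3⟩⟩ := ih
    refine ⟨Sum.elim lam fun
      | .nw => lam (T.data.corner .ne)
      | .sw => lam (T.data.corner .se)
      | .se => lam (T.data.corner .ne)
      | .ne => 2 * lam (T.data.corner .ne) - lam (T.data.corner .se),
      ⟨IsColoring.hsum_iff.2 ⟨hl, IsColoring.neg_iff.2 ⟨rfl, rfl⟩, rfl, rfl⟩, ?_⟩, ⟨?_, ?_, ?_⟩⟩
    · intro X _ hX c hc
      obtain ⟨hc1, hc2, e1, e2⟩ := IsColoring.hsum_iff.1 hc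
      obtain ⟨e3, e4⟩ := IsColoring.neg_iff.1 hc2
      obtain ⟨f, hf, hcf⟩ := hu X hX _ hc1
      rw [hcf] at e1 e2
      refine ⟨f, hf, ?_⟩
      rintro (x | _ | _ | _ | _)
      · exact hcf x
      · exact e1.symm
      · exact e4.symm.trans (hf.act_eq e1.symm e2.symm)
      · exact e2.symm
      · exact e3.symm.trans e1.symm
    · change 2 * lam (T.data.corner .ne) - lam (T.data.corner .se) =
        lam (T.data.corner .nw) - (a - b)
      omega
    · exact h2
    · change lam (T.data.corner .ne) = lam (T.data.corner .nw) - (a - b) - b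
      omega
  | @left_pos T a b _ ih =>
    obtain ⟨lam, ⟨hl, hu⟩, ⟨h1, h2, h3⟩⟩ := ih
    refine ⟨Sum.elim (fun
      | .ne => lam (T.data.corner .nw)
      | .se => lam (T.data.corner .sw)
      | .sw => lam (T.data.corner .nw)
      | .nw => 2 * lam (T.data.corner .nw) - lam (T.data.corner .sw)) lam,
      ⟨IsColoring.hsum_iff.2 ⟨IsColoring.pos_iff.2 ⟨rfl, sub_sub_cancel _ _⟩, hl, rfl, rfl⟩, ?_⟩,
      ⟨?_, ?_, ?_⟩⟩
    · intro X _ hX c hc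
      obtain ⟨hc2, hc1, e1, e2⟩ := IsColoring.hsum_iff.1 hc
      obtain ⟨e3, e4⟩ := IsColoring.pos_iff.1 hc2
      obtain ⟨f, hf, hcf⟩ := hu X hX _ hc1
      rw [hcf] at e1 e2
      refine ⟨f, hf, ?_⟩
      rintro ((_ | _ | _ | _) | x)
      · exact (hX.eq_act e4).trans (hf.act_eq (e3.trans e1) e2)
      · exact e1
      · exact e3.trans e1
      · exact e2
      · exact hcf x
    · change lam (T.data.corner .ne) =
        2 * lam (T.data.corner .nw) - lam (T.data.corner .sw) - (a + b)
      omega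
    · change lam (T.data.corner .nw) = 2 * lam (T.data.corner .nw) - lam (T.data.corner .sw) - b
      omega
    · change lam (T.data.corner .se) =
        2 * lam (T.data.corner .nw) - lam (T.data.corner .sw) - (a + b) - b
      omega
  | @left_neg T a b _ ih =>
    obtain ⟨lam, ⟨hl, hu⟩, ⟨h1, h2, h3⟩⟩ := ih
    refine ⟨Sum.elim (fun
      | .ne => lam (T.data.corner .nw)
      | .se => lam (T.data.corner .sw)
      | .nw => lam (T.data.corner .sw)
      | .sw => 2 * lam (T.data.corner .sw) - lam (T.data.corner .nw)) lam,
      ⟨IsColoring.hsum_iff.2 ⟨IsColoring.neg_iff.2 ⟨rfl, sub_sub_cancel _ _⟩, hl, rfl, rfl⟩, ?_⟩,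
      ⟨?_, ?_, ?_⟩⟩
    · intro X _ hX c hc
      obtain ⟨hc2, hc1, e1, e2⟩ := IsColoring.hsum_iff.1 hc
      obtain ⟨e3, e4⟩ := IsColoring.neg_iff.1 hc2
      obtain ⟨f, hf, hcf⟩ := hu X hX _ hc1
      rw [hcf] at e1 e2
      refine ⟨f, hf, ?_⟩
      rintro ((_ | _ | _ | _) | x)
      · exact e3.trans e2
      · exact e1
      · exact (hX.eq_act e4).trans (hf.act_eq (e3.trans e2) e1)
      · exact e2
      · exact hcf x
    · change lam (T.data.corner .ne) = lam (T.data.corner .sw) - (a - b)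
      omega
    · change 2 * lam (T.data.corner .sw) - lam (T.data.corner .nw) = lam (T.data.corner .sw) - b
      omega
    · change lam (T.data.corner .se) = lam (T.data.corner .sw) - (a - b) - b
      omega
  | @bottom_pos T a b _ ih =>
    obtain ⟨lam, ⟨hl, hu⟩, ⟨h1, h2, h3⟩⟩ := ih
    refine ⟨Sum.elim lam fun
      | .nw => lam (T.data.corner .sw)
      | .ne => lam (T.data.corner .se)
      | .sw => lam (T.data.corner .se)
      | .se => 2 * lam (T.data.corner .se) - lam (T.data.corner .sw),
      ⟨IsColoring.vsum_iff.2 ⟨hl, IsColoring.pos_iff.2 ⟨rfl, rfl⟩, rfl, rfl⟩, ?_⟩, ⟨?_, ?_, ?_⟩⟩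
    · intro X _ hX c hc
      obtain ⟨hc1, hc2, e1, e2⟩ := IsColoring.vsum_iff.1 hc
      obtain ⟨e3, e4⟩ := IsColoring.pos_iff.1 hc2
      obtain ⟨f, hf, hcf⟩ := hu X hX _ hc1
      rw [hcf] at e1 e2
      refine ⟨f, hf, ?_⟩
      rintro (x | _ | _ | _ | _)
      · exact hcf x
      · exact e1.symm
      · exact e2.symm
      · exact e3.trans e2.symm
      · exact e4.symm.trans (hf.act_eq (e3.trans e2.symm) e1.symm)
    · exact h1
    · change lam (T.data.corner .se) = lam (T.data.corner .nw) - (b + a)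
      omega
    · change 2 * lam (T.data.corner .se) - lam (T.data.corner .sw) =
        lam (T.data.corner .nw) - a - (b + a)
      omega
  | @bottom_neg T a b _ ih =>
    obtain ⟨lam, ⟨hl, hu⟩, ⟨h1, h2, h3⟩⟩ := ih
    refine ⟨Sum.elim lam fun
      | .nw => lam (T.data.corner .sw)
      | .ne => lam (T.data.corner .se)
      | .se => lam (T.data.corner .sw)
      | .sw => 2 * lam (T.data.corner .sw) - lam (T.data.corner .se),
      ⟨IsColoring.vsum_iff.2 ⟨hl, IsColoring.neg_iff.2 ⟨rfl, sub_sub_cancel _ _⟩, rfl, rfl⟩, ?_⟩,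
      ⟨?_, ?_, ?_⟩⟩
    · intro X _ hX c hc
      obtain ⟨hc1, hc2, e1, e2⟩ := IsColoring.vsum_iff.1 hc
      obtain ⟨e3, e4⟩ := IsColoring.neg_iff.1 hc2
      obtain ⟨f, hf, hcf⟩ := hu X hX _ hc1
      rw [hcf] at e1 e2
      refine ⟨f, hf, ?_⟩
      rintro (x | _ | _ | _ | _)
      · exact hcf x
      · exact e1.symm
      · exact e2.symm
      · exact (hX.eq_act e4).trans (hf.act_eq e1.symm e2.symm)
      · exact e3.symm.trans e1.symm
    · exact h1
    · change 2 * lam (T.data.corner .sw) - lam (T.data.corner .se) =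
        lam (T.data.corner .nw) - (b - a)
      omega
    · change lam (T.data.corner .sw) = lam (T.data.corner .nw) - a - (b - a)
      omega
  | @top_pos T a b _ ih =>
    obtain ⟨lam, ⟨hl, hu⟩, ⟨h1, h2, h3⟩⟩ := ih
    refine ⟨Sum.elim (fun
      | .sw => lam (T.data.corner .nw)
      | .se => lam (T.data.corner .ne)
      | .ne => lam (T.data.corner .nw)
      | .nw => 2 * lam (T.data.corner .nw) - lam (T.data.corner .ne)) lam,
      ⟨IsColoring.vsum_iff.2 ⟨IsColoring.pos_iff.2 ⟨rfl, sub_sub_cancel _ _⟩, hl, rfl, rfl⟩, ?_⟩,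
      ⟨?_, ?_, ?_⟩⟩
    · intro X _ hX c hc
      obtain ⟨hc2, hc1, e1, e2⟩ := IsColoring.vsum_iff.1 hc
      obtain ⟨e3, e4⟩ := IsColoring.pos_iff.1 hc2
      obtain ⟨f, hf, hcf⟩ := hu X hX _ hc1
      rw [hcf] at e1 e2
      refine ⟨f, hf, ?_⟩
      rintro ((_ | _ | _ | _) | x)
      · exact (hX.eq_act e4).trans (hf.act_eq e1 e2)
      · exact e3.symm.trans e1
      · exact e1
      · exact e2
      · exact hcf x
    · change lam (T.data.corner .nw) = 2 * lam (T.data.corner .nw) - lam (T.data.corner .ne) - a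
      omega
    · change lam (T.data.corner .sw) =
        2 * lam (T.data.corner .nw) - lam (T.data.corner .ne) - (b + a)
      omega
    · change lam (T.data.corner .se) =
        2 * lam (T.data.corner .nw) - lam (T.data.corner .ne) - a - (b + a)
      omega
  | @top_neg T a b _ ih =>
    obtain ⟨lam, ⟨hl, hu⟩, ⟨h1, h2, h3⟩⟩ := ih
    refine ⟨Sum.elim (fun
      | .sw => lam (T.data.corner .nw)
      | .se => lam (T.data.corner .ne)
      | .nw => lam (T.data.corner .ne)
      | .ne => 2 * lam (T.data.corner .ne) - lam (T.data.corner .nw)) lam,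
      ⟨IsColoring.vsum_iff.2 ⟨IsColoring.neg_iff.2 ⟨rfl, rfl⟩, hl, rfl, rfl⟩, ?_⟩, ⟨?_, ?_, ?_⟩⟩
    · intro X _ hX c hc
      obtain ⟨hc2, hc1, e1, e2⟩ := IsColoring.vsum_iff.1 hc
      obtain ⟨e3, e4⟩ := IsColoring.neg_iff.1 hc2
      obtain ⟨f, hf, hcf⟩ := hu X hX _ hc1
      rw [hcf] at e1 e2
      refine ⟨f, hf, ?_⟩
      rintro ((_ | _ | _ | _) | x)
      · exact e3.trans e2
      · exact e4.symm.trans (hf.act_eq (e3.trans e2) e1)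
      · exact e1
      · exact e2
      · exact hcf x
    · change 2 * lam (T.data.corner .ne) - lam (T.data.corner .nw) = lam (T.data.corner .ne) - a
      omega
    · change lam (T.data.corner .sw) = lam (T.data.corner .ne) - (b - a)
      omega
    · change lam (T.data.corner .se) = lam (T.data.corner .ne) - a - (b - a)
      omega

theorem Tangle.Twist.isCoprime {T : Tangle} {a b : ℤ} (h : T.Twist a b) : IsCoprime a b := by
  induction h with
  | zero => exact isCoprime_zero_left.2 isUnit_one
  | infty => exact isCoprime_zero_right.2 isUnit_one
  | right_pos _ ih => simpa using ih.add_mul_left_left 1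
  | left_pos _ ih => simpa using ih.add_mul_left_left 1
  | right_neg _ ih => simpa [sub_eq_add_neg] using ih.add_mul_left_left (-1)
  | left_neg _ ih => simpa [sub_eq_add_neg] using ih.add_mul_left_left (-1)
  | bottom_pos _ ih => simpa using ih.add_mul_left_right 1
  | top_pos _ ih => simpa using ih.add_mul_left_right 1
  | bottom_neg _ ih => simpa [sub_eq_add_neg] using ih.add_mul_left_right (-1)
  | top_neg _ ih => simpa [sub_eq_add_neg] using ih.add_mul_left_right (-1)

/-- A universal colouring of a tangle with fraction `a / b` and prescribed corner colours. -/
structure Tangle.IsNormalized (T : Tangle) (lam : T.data.Arc → ℤ) (a b : ℤ) : Prop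
    extends T.IsUniversal lam where
  nw : lam (T.data.corner .nw) = 0
  ne : lam (T.data.corner .ne) = a
  sw : lam (T.data.corner .sw) = b
  se : lam (T.data.corner .se) = a + b

/-- Universality survives the affine bijections k ↦ ε (n - k) of ℤ with ε = ±1, which preserve the
dihedral operation. The sign is kept free because a fraction determines its coprime numerator and
denominator only up to a common sign. -/
theorem Tangle.Twist.exists_isNormalized {T : Tangle} {a b ε : ℤ} (h : T.Twist a b)
    (hε : ε * ε = 1) : ∃ lam, T.IsNormalized lam (ε * a) (ε * b) := by
  obtain ⟨lam, ⟨⟨hl, hl'⟩, hu⟩, h1, h2, h3⟩ := h.exists_isUniversal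
  set n := lam (T.data.corner .nw)
  refine ⟨fun x => ε * (n - lam x), ⟨⟨⟨fun x y h => by simp only [hl x y h], fun o u v h => ?_⟩, ?_⟩,
    ?_, ?_, ?_, ?_⟩⟩
  · simp only [← hl' o u v h]
    ring
  · intro X _ hX c hc
    obtain ⟨f, hf, hcf⟩ := hu X hX c hc
    refine ⟨_, hf.comp_affine n (-ε), fun x => ?_⟩
    rw [hcf, ← mul_assoc, neg_mul, hε]
    ring_nf
  · simp [n]
  · rw [h1]; ring
  · rw [h2]; ring
  · rw [h3]; ring

theorem Tangle.IsRational.exists_isNormalized {T : Tangle} {p q : ℤ} (hq : 0 < q)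
    (hpq : IsCoprime p q) (h : T.IsRational ((p : ℚ) / q)) : ∃ lam, T.IsNormalized lam p q := by
  obtain ⟨a, b, hT, hb, hab⟩ := h
  have hab' : a * q = p * b := by
    have : (q : ℚ) ≠ 0 := by exact_mod_cast hq.ne'
    have hb' : (b : ℚ) ≠ 0 := by exact_mod_cast hb
    rw [div_eq_div_iff hb' this] at hab
    exact_mod_cast hab
  have h1 : b ∣ q := hT.isCoprime.symm.dvd_of_dvd_mul_left ⟨p, by rw [hab', mul_comm]⟩
  have h2 : q ∣ b := hpq.symm.dvd_of_dvd_mul_left ⟨a, by rw [← hab', mul_comm]⟩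
  rcases Int.associated_iff.1 (associated_of_dvd_dvd h1 h2) with rfl | rfl
  · have : a = p := mul_right_cancel₀ hb hab'
    subst this
    simpa using hT.exists_isNormalized (ε := 1) rfl
  · have : a = -p := by
      apply mul_right_cancel₀ hq.ne'
      rw [hab']; ring
    subst this
    simpa using hT.exists_isNormalized (ε := -1) rfl

theorem Tangle.twist_halfTwists (e : ℤ) : (Tangle.halfTwists e).Twist (-e) 1 := by
  have hneg : ∀ n : ℕ, (Tangle.row .neg n).Twist (-n) 1 := by
    intro n
    induction n with
    | zero => exact .zero
    | succ n ih =>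
      have := ih.right_neg
      rwa [← neg_add'] at this
  have hpos : ∀ n : ℕ, (Tangle.row .pos n).Twist n 1 := by
    intro n
    induction n with
    | zero => exact .zero
    | succ n ih => exact ih.right_pos
  cases e with
  | ofNat n => exact hneg n
  | negSucc n => simpa using! hpos (n + 1)

/-! ## Coordinates on an involutory quandle -/

/-- The three moves are the actions of the generators on the indices of `a`. Their composites shift
m by 2 and x by 1 (with a change of sign of m). The parity of m never changes, so two starting
points are needed. -/
theorem int_pair_induction {C : ℤ → ℤ → Prop} (h0 : C 0 0) (h1 : C 0 1)
    (s1 : ∀ x m, C x m → C (-x) (-m)) (s2 : ∀ x m, C x m → C (1 - x) m)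
    (s3 : ∀ x m, C x m → C (-x) (2 - m)) (x m : ℤ) : C x m := by
  have up : ∀ x m, C x m → C x (m + 2) := fun x m h => by
    convert s3 _ _ (s1 _ _ h) using 1 <;> ring
  have down : ∀ x m, C x m → C x (m - 2) := fun x m h => by
    convert s1 _ _ (s3 _ _ h) using 1 <;> ring
  have right : ∀ x m, C x m → C (x + 1) (-m) := fun x m h => by
    convert s2 _ _ (s1 _ _ h) using 1; ring
  have left : ∀ x m, C x m → C (x - 1) (-m) := fun x m h => by
    convert s1 _ _ (s2 _ _ h) using 1; ring
  have base : ∀ m : ℤ, C 0 (2 * m) ∧ C 0 (2 * m + 1) := by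
    intro m
    induction m using Int.induction_on with
    | zero => exact ⟨h0, h1⟩
    | succ n ih =>
      refine ⟨?_, ?_⟩
      · convert up _ _ ih.1 using 1; ring
      · convert up _ _ ih.2 using 1; ring
    | pred n ih =>
      refine ⟨?_, ?_⟩
      · convert down _ _ ih.1 using 1; ring
      · convert down _ _ ih.2 using 1; ring
  induction x using Int.induction_on generalizing m with
  | zero =>
    rcases Int.even_or_odd' m with ⟨n, rfl | rfl⟩
    exacts [(base n).1, (base n).2]
  | succ n ih => simpa using right _ _ (ih (-m))
  | pred n ih => simpa using left _ _ (ih (-m))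

theorem int_reflection_induction {C : ℤ → Prop} (h0 : C 0) (s1 : ∀ n, C n → C (-n - 1))
    (s2 : ∀ n, C n → C (-n)) (n : ℤ) : C n := by
  induction n using Int.induction_on with
  | zero => exact h0
  | succ n ih => convert s2 _ (s1 _ ih) using 1; ring
  | pred n ih => convert s1 _ (s2 _ ih) using 1; ring

/-- The functions `a` and `b` parametrize the orbits of `x₁`, `x₃` and of `x₂` under the group
generated by the actions of `x₁`, `x₂` and `x₃`. -/
structure IsCoordinates {Q : Type} [Quandle Q] (x₁ x₂ x₃ : Q) (a : ℤ → ℤ → Q) (b : ℤ → Q) :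
    Prop where
  a_zero_zero : a 0 0 = x₁
  a_zero_one : a 0 1 = x₃
  b_zero : b 0 = x₂
  one_a : ∀ x m, x₁ ◃ a x m = a (-x) (-m)
  two_a : ∀ x m, x₂ ◃ a x m = a (1 - x) m
  three_a : ∀ x m, x₃ ◃ a x m = a (-x) (2 - m)
  one_b : ∀ n, x₁ ◃ b n = b (-n - 1)
  two_b : ∀ n, x₂ ◃ b n = b (-n)
  three_b : ∀ n, x₃ ◃ b n = b (-n - 1)

/-- The hypothesis says that P = s₃s₁ commutes with s₂, while s₁ and s₃ invert it. The group is thus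
generated by P, N = s₂s₁ (or M = s₂s₃ = N P⁻¹) and one involution. The elements are translates of a
base point: P^j N^x x₁ for even m, P^j M^x x₃ for odd m, and N^n x₂. The choice between N and M lets
the involution fixing the base point be the one that also inverts the translation. -/
theorem exists_isCoordinates {Q : Type} [Quandle Q] (hQ : Rack.IsInvolutory Q) {x₁ x₂ x₃ : Q}
    (h : x₁ ◃ x₂ = x₃ ◃ x₂) : ∃ a b, IsCoordinates x₁ x₂ x₃ a b := by
  set s₁ : Equiv.Perm Q := Rack.act' x₁ with hs₁
  set s₂ : Equiv.Perm Q := Rack.act' x₂ with hs₂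
  set s₃ : Equiv.Perm Q := Rack.act' x₃ with hs₃
  have i₁ : s₁⁻¹ = s₁ := hQ.act'_inv x₁
  have i₂ : s₂⁻¹ = s₂ := hQ.act'_inv x₂
  have i₃ : s₃⁻¹ = s₃ := hQ.act'_inv x₃
  have k₁ : s₁ * s₁ = 1 := hQ.act'_mul_self x₁
  have k₂ : s₂ * s₂ = 1 := hQ.act'_mul_self x₂
  have k₃ : s₃ * s₃ = 1 := hQ.act'_mul_self x₃
  have rel : s₁ * s₂ * s₁ = s₃ * s₂ * s₃ := by
    have h1 := Rack.ad_conj x₁ x₂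
    have h2 := Rack.ad_conj x₃ x₂
    rw [hQ.act'_inv] at h1 h2
    rw [hs₁, hs₂, hs₃, ← h1, ← h2, h]
  set P := s₃ * s₁ with hP
  set N := s₂ * s₁ with hN
  set M := s₂ * s₃ with hM
  have iP : P⁻¹ = s₁ * s₃ := by rw [hP, mul_inv_rev, i₁, i₃]
  have iN : N⁻¹ = s₁ * s₂ := by rw [hN, mul_inv_rev, i₁, i₂]
  have iM : M⁻¹ = s₃ * s₂ := by rw [hM, mul_inv_rev, i₂, i₃]
  have c1P : SemiconjBy s₁ P P⁻¹ := by
    rw [SemiconjBy, iP, hP, mul_assoc]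
  have c3P : SemiconjBy s₃ P P⁻¹ := by
    rw [SemiconjBy, iP, hP, ← mul_assoc, k₃, mul_assoc, k₃, one_mul, mul_one]
  have c1N : SemiconjBy s₁ N N⁻¹ := by
    rw [SemiconjBy, iN, hN, mul_assoc]
  have c3M : SemiconjBy s₃ M M⁻¹ := by
    rw [SemiconjBy, iM, hM, mul_assoc]
  have c2P : SemiconjBy s₂ P P := by
    rw [SemiconjBy, hP]
    calc s₂ * (s₃ * s₁) = s₃ * (s₃ * s₂ * s₃) * s₁ := by
          rw [← mul_assoc s₃, ← mul_assoc s₃, k₃, one_mul, mul_assoc]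
      _ = s₃ * (s₁ * s₂ * s₁) * s₁ := by rw [rel]
      _ = s₃ * s₁ * s₂ := by rw [mul_assoc, mul_assoc, k₁, mul_one, mul_assoc]
  have cNP : SemiconjBy N P P⁻¹ := c2P.inv_right.mul_left c1P
  have cMP : SemiconjBy M P P⁻¹ := c2P.inv_right.mul_left c3P
  have e₃ : s₃ = P * s₁ := by rw [hP, mul_assoc, k₁, mul_one]
  have e₁ : s₁ = P⁻¹ * s₃ := by rw [iP, mul_assoc, k₃, mul_one]
  have e₂ : s₂ = N * s₁ := by rw [hN, mul_assoc, k₁, mul_one]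
  have e₂' : s₂ = M * s₃ := by rw [hM, mul_assoc, k₃, mul_one]
  have zp : ∀ {u g : Equiv.Perm Q}, SemiconjBy u g g⁻¹ → ∀ (n : ℤ) y,
      u ((g ^ n) y) = (g ^ (-n)) (u y) := by
    intro u g hu n y
    have := (hu.zpow_right n).eq
    rw [inv_zpow, ← zpow_neg] at this
    exact congrArg (fun v : Equiv.Perm Q => v y) this
  have add : ∀ (g : Equiv.Perm Q) (n k : ℤ) y, (g ^ n) ((g ^ k) y) = (g ^ (n + k)) y := by
    intro g n k y
    rw [zpow_add]; rfl
  have add1 : ∀ (g : Equiv.Perm Q) (k : ℤ) y, g ((g ^ k) y) = (g ^ (1 + k)) y := by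
    intro g k y
    rw [zpow_one_add]; rfl
  have addi : ∀ (g : Equiv.Perm Q) (k : ℤ) y, g⁻¹ ((g ^ k) y) = (g ^ (-1 + k)) y := by
    intro g k y
    rw [zpow_add, zpow_neg_one]; rfl
  have f1 : s₁ x₁ = x₁ := Quandle.fix
  have f2 : s₂ x₂ = x₂ := Quandle.fix
  have f3 : s₃ x₃ = x₃ := Quandle.fix
  let a : ℤ → ℤ → Q := fun x m =>
    (P ^ (m / 2)) (if m % 2 = 0 then (N ^ x) x₁ else (M ^ x) x₃)
  have a0 : ∀ x j, a x (2 * j) = (P ^ j) ((N ^ x) x₁) := by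
    intro x j
    have h1 : 2 * j / 2 = j := by omega
    have h2 : 2 * j % 2 = 0 := by omega
    simp only [a, h1, h2, if_true]
  have a1 : ∀ x j, a x (2 * j + 1) = (P ^ j) ((M ^ x) x₃) := by
    intro x j
    have h1 : (2 * j + 1) / 2 = j := by omega
    have h2 : ¬ (2 * j + 1) % 2 = 0 := by omega
    simp only [a, h1, h2, if_false]
  have Pfix : ∀ n : ℤ, P ((N ^ n) x₂) = (N ^ n) x₂ := by
    have h0 : P x₂ = x₂ := by
      change x₃ ◃ (x₁ ◃ x₂) = x₂
      rw [h, hQ]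
    have h0' : P⁻¹ x₂ = x₂ := by rw [Equiv.Perm.inv_eq_iff_eq, h0]
    -- The sign alternates with n but is irrelevant: both P and P⁻¹ fix x₂.
    have key : ∀ n : ℤ, SemiconjBy (N ^ n) P P ∨ SemiconjBy (N ^ n) P P⁻¹ := by
      intro n
      induction n using Int.induction_on with
      | zero => left; rw [zpow_zero]; exact SemiconjBy.one_left P
      | succ n ih =>
        rw [zpow_add_one]
        rcases ih with ih | ih
        · exact .inr (ih.inv_right.mul_left cNP)
        · left
          have := ih.inv_right.mul_left cNP
          rwa [inv_inv] at this
      | pred n ih =>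
        rw [zpow_sub_one]
        have cNP' : SemiconjBy N⁻¹ P P⁻¹ := by
          have := cNP.inv_right
          rw [inv_inv] at this
          exact this.inv_symm_left
        rcases ih with ih | ih
        · exact .inr (ih.inv_right.mul_left cNP')
        · left
          have := ih.inv_right.mul_left cNP'
          rwa [inv_inv] at this
    intro n
    rcases key n with hn | hn
    · have := congrArg (fun v : Equiv.Perm Q => v x₂) hn.eq
      simp only [Equiv.Perm.mul_apply, h0] at this
      exact this.symm
    · have := congrArg (fun v : Equiv.Perm Q => v x₂) hn.eq
      simp only [Equiv.Perm.mul_apply, h0] at this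
      exact ((Equiv.Perm.inv_eq_iff_eq).1 this.symm).symm
  have oneb : ∀ n : ℤ, s₁ ((N ^ n) x₂) = (N ^ (-n - 1)) x₂ := by
    intro n
    have : s₁ x₂ = (N ^ (-1 : ℤ)) x₂ := by
      rw [zpow_neg_one, iN, Equiv.Perm.mul_apply, f2]
    rw [zp c1N, this, add]; rfl
  have c2N : SemiconjBy s₂ N N⁻¹ := by
    rw [SemiconjBy, iN, hN, ← mul_assoc, k₂, mul_assoc, k₂, one_mul, mul_one]
  refine ⟨a, fun n => (N ^ n) x₂, ?_, ?_, ?_, ?_, ?_, ?_, ?_, ?_, ?_⟩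
  · simpa using a0 0 0
  · simpa using a1 0 0
  · simp
  · intro x m
    change s₁ _ = _
    rcases Int.even_or_odd' m with ⟨j, rfl | rfl⟩
    · rw [show -(2 * j) = 2 * (-j) by ring, a0, a0, zp c1P, zp c1N, f1]
    · rw [show -(2 * j + 1) = 2 * (-1 + -j) + 1 by ring, a1, a1, e₁, Equiv.Perm.mul_apply, zp c3P,
        zp c3M, f3, addi]
  · intro x m
    change s₂ _ = _
    rcases Int.even_or_odd' m with ⟨j, rfl | rfl⟩
    · rw [a0, a0, e₂, Equiv.Perm.mul_apply, zp c1P, zp c1N, f1, zp cNP, add1, neg_neg]; rfl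
    · rw [a1, a1, e₂', Equiv.Perm.mul_apply, zp c3P, zp c3M, f3, zp cMP, add1, neg_neg]; rfl
  · intro x m
    change s₃ _ = _
    rcases Int.even_or_odd' m with ⟨j, rfl | rfl⟩
    · rw [show 2 - (2 * j) = 2 * (1 + -j) by ring, a0, a0, e₃, Equiv.Perm.mul_apply, zp c1P, zp c1N,
        f1, add1]
    · rw [show 2 - (2 * j + 1) = 2 * (-j) + 1 by ring, a1, a1, zp c3P, zp c3M, f3]
  · exact oneb
  · intro n
    change s₂ _ = _
    rw [zp c2N, f2]
  · intro n
    change s₃ _ = _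
    rw [e₃, Equiv.Perm.mul_apply, oneb, Pfix]

namespace IsCoordinates

variable {Q : Type} [Quandle Q] {x₁ x₂ x₃ : Q} {a : ℤ → ℤ → Q} {b : ℤ → Q}

theorem act_act (hQ : Rack.IsInvolutory Q) (s y z : Q) : (s ◃ y) ◃ z = s ◃ (y ◃ (s ◃ z)) := by
  rw [Shelf.self_distrib, hQ s z]

/-- Acting by s ◃ y is acting by y conjugated with s (`act_act`), so the formulas spread from x₁ and
x₃ over their orbits. -/
theorem a_act (h : IsCoordinates x₁ x₂ x₃ a b) (hQ : Rack.IsInvolutory Q) (x m : ℤ) :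
    (∀ x' m', a x m ◃ a x' m' = a (2 * x - x') (2 * m - m')) ∧
      ∀ n, a x m ◃ b n = b (2 * x - 1 - n) := by
  induction x, m using int_pair_induction with
  | h0 =>
    rw [h.a_zero_zero]
    refine ⟨fun x' m' => by simp [h.one_a], fun n => ?_⟩
    rw [h.one_b]; congr 1; ring
  | h1 =>
    rw [h.a_zero_one]
    refine ⟨fun x' m' => by simp [h.three_a], fun n => ?_⟩
    rw [h.three_b]; congr 1; ring
  | s1 x m ih =>
    rw [← h.one_a]
    refine ⟨fun x' m' => ?_, fun n => ?_⟩
    · rw [act_act hQ, h.one_a, ih.1, h.one_a]; congr 1 <;> ring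
    · rw [act_act hQ, h.one_b, ih.2, h.one_b]; congr 1; ring
  | s2 x m ih =>
    rw [← h.two_a]
    refine ⟨fun x' m' => ?_, fun n => ?_⟩
    · rw [act_act hQ, h.two_a, ih.1, h.two_a]; congr 1; ring
    · rw [act_act hQ, h.two_b, ih.2, h.two_b]; congr 1; ring
  | s3 x m ih =>
    rw [← h.three_a]
    refine ⟨fun x' m' => ?_, fun n => ?_⟩
    · rw [act_act hQ, h.three_a, ih.1, h.three_a]; congr 1 <;> ring
    · rw [act_act hQ, h.three_b, ih.2, h.three_b]; congr 1; ring

theorem b_act (h : IsCoordinates x₁ x₂ x₃ a b) (hQ : Rack.IsInvolutory Q) (n : ℤ) :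
    (∀ x m, b n ◃ a x m = a (2 * n + 1 - x) m) ∧ ∀ n', b n ◃ b n' = b (2 * n - n') := by
  induction n using int_reflection_induction with
  | h0 =>
    rw [h.b_zero]
    exact ⟨fun x m => by simp [h.two_a], fun n => by simp [h.two_b]⟩
  | s1 n ih =>
    rw [← h.one_b]
    refine ⟨fun x' m' => ?_, fun n => ?_⟩
    · rw [act_act hQ, h.one_a, ih.1, h.one_a]; congr 1 <;> ring
    · rw [act_act hQ, h.one_b, ih.2, h.one_b]; congr 1; ring
  | s2 n ih =>
    rw [← h.two_b]
    refine ⟨fun x' m' => ?_, fun n => ?_⟩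
    · rw [act_act hQ, h.two_a, ih.1, h.two_a]; congr 1; ring
    · rw [act_act hQ, h.two_b, ih.2, h.two_b]; congr 1; ring

/-- Rows and columns of `a` are themselves dihedral homomorphisms. Two given values per row identify
the rows j = 0 and j = 1 with progressions of `f`; these two rows then identify every column. -/
theorem dihedralHom_eq (h : IsCoordinates x₁ x₂ x₃ a b) (hQ : Rack.IsInvolutory Q) {f : ℤ → Q}
    (hf : IsDihedralHom f) {q w : ℤ} (h0 : f 0 = a 0 1) (h1 : f q = a 1 1) (h2 : f (-w) = a 0 0)
    (h3 : f (-w - q) = a (-1) 0) (i j : ℤ) : f (q * i - w * j) = a i (1 - j) := by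
  have row : ∀ m, IsDihedralHom fun i => a i m := by
    intro m i j
    rw [(h.a_act hQ _ _).1]
    congr 1; ring
  have col : ∀ i, IsDihedralHom fun j => a i (1 - j) := by
    intro i j k
    rw [(h.a_act hQ _ _).1]
    congr 1 <;> ring
  have r0 : ∀ i, f (0 + q * i) = a i 1 :=
    (hf.comp_affine 0 q).ext_of_eq (row 1) 0 (by simpa using h0) (by simpa using h1)
  have r1 : ∀ i, f (-w + q * i) = a i 0 :=
    (hf.comp_affine (-w) q).ext_of_eq (row 0) (-1) (by simpa [← sub_eq_add_neg] using h3)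
      (by simpa using h2)
  have := (hf.comp_affine (q * i) (-w)).ext_of_eq (col i) 0 (by simpa using r0 i)
    (by have := r1 i; rw [add_comm] at this; simpa using this) j
  rwa [neg_mul, ← sub_eq_add_neg] at this

/-- The number q i - w j does not change when (i, j) moves by (w, q), which gives the period (w, -q)
of `a`. The action of x₂ reflects it to the period (w, q). -/
theorem a_eq_of_dihedralHom (h : IsCoordinates x₁ x₂ x₃ a b) {f : ℤ → Q} {q w : ℤ}
    (hf : ∀ i j, f (q * i - w * j) = a i (1 - j)) (x m i j : ℤ) :
    a (x + (i + j) * w) (m + (i - j) * q) = a x m := by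
  have minus : ∀ x m j, a (x + j * w) (m - j * q) = a x m := by
    intro x m j
    have h1 := hf (x + j * w) (1 - (m - j * q))
    have h2 := hf x (1 - m)
    rw [sub_sub_cancel] at h1 h2
    rw [← h1, ← h2]
    congr 1; ring
  have plus : ∀ x m i, a (x + i * w) (m + i * q) = a x m := by
    intro x m i
    have := congrArg (x₂ ◃ ·) (minus (1 - x) m (-i))
    simp only [h.two_a] at this
    convert this using 2 <;> ring
  rw [← plus x m i, ← minus (x + i * w) (m + i * q) j]
  congr 1 <;> ring

/-- The equal elements a(0,0) and a(iw,iq) act on the b's as reflections of the index whose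
composite is the shift by 2wi. -/
theorem b_eq_of_dihedralHom (h : IsCoordinates x₁ x₂ x₃ a b) (hQ : Rack.IsInvolutory Q)
    {f : ℤ → Q} {q w : ℤ} (hf : ∀ i j, f (q * i - w * j) = a i (1 - j)) (n i : ℤ) :
    b (n + 2 * w * i) = b n := by
  have h1 := (h.a_act hQ 0 0).2 (-1 - n)
  have h2 := (h.a_act hQ (0 + (i + 0) * w) (0 + (i - 0) * q)).2 (-1 - n)
  rw [h.a_eq_of_dihedralHom hf, h1] at h2
  convert h2.symm using 2 <;> ring

end IsCoordinates

/-! ## The model of the link quandle -/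

/-- The operation on the model: `inl (x, m)` and `inr n` are the rotation by `π` about `(x, 2 m)`
and the reflection across the line with abscissa `n + 1 / 2`. -/
def modelOp : (ℤ × ℤ) ⊕ ℤ → (ℤ × ℤ) ⊕ ℤ → (ℤ × ℤ) ⊕ ℤ
  | .inl u, .inl v => .inl (2 * u.1 - v.1, 2 * u.2 - v.2)
  | .inl u, .inr n => .inr (2 * u.1 - 1 - n)
  | .inr n, .inl u => .inl (2 * n + 1 - u.1, u.2)
  | .inr n, .inr k => .inr (2 * n - k)

/-- The congruence on the model whose quotient is the quandle of the link. -/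
def ModelRel (w q : ℤ) : (ℤ × ℤ) ⊕ ℤ → (ℤ × ℤ) ⊕ ℤ → Prop
  | .inl u, .inl v => ∃ i j : ℤ, v.1 = u.1 + (i + j) * w ∧ v.2 = u.2 + (i - j) * q
  | .inr n, .inr k => ∃ i : ℤ, k = n + 2 * w * i
  | .inl _, .inr _ => False
  | .inr _, .inl _ => False

theorem modelOp_idem (x : (ℤ × ℤ) ⊕ ℤ) : modelOp x x = x := by
  rcases x with ⟨x, m⟩ | n <;> simp only [modelOp] <;> ring_nf

theorem modelOp_invol (x y : (ℤ × ℤ) ⊕ ℤ) : modelOp x (modelOp x y) = y := by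
  rcases x with ⟨x, m⟩ | n <;> rcases y with ⟨x', m'⟩ | n' <;> simp only [modelOp] <;> ring_nf

theorem modelOp_distrib (x y z : (ℤ × ℤ) ⊕ ℤ) :
    modelOp x (modelOp y z) = modelOp (modelOp x y) (modelOp x z) := by
  rcases x with ⟨x, m⟩ | n <;> rcases y with ⟨x', m'⟩ | n' <;> rcases z with ⟨x'', m''⟩ | n'' <;>
    simp only [modelOp] <;> ring_nf

namespace ModelRel

variable {w q : ℤ}

theorem refl (x : (ℤ × ℤ) ⊕ ℤ) : ModelRel w q x x := by
  rcases x with ⟨x, m⟩ | n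
  · exact ⟨0, 0, by simp, by simp⟩
  · exact ⟨0, by simp⟩

theorem symm {x y : (ℤ × ℤ) ⊕ ℤ} (h : ModelRel w q x y) : ModelRel w q y x := by
  rcases x with ⟨x, m⟩ | n <;> rcases y with ⟨x', m'⟩ | n' <;> simp only [ModelRel] at h ⊢
  · obtain ⟨i, j, rfl, rfl⟩ := h
    exact ⟨-i, -j, by ring, by ring⟩
  · obtain ⟨i, rfl⟩ := h
    exact ⟨-i, by ring⟩

theorem trans {x y z : (ℤ × ℤ) ⊕ ℤ} (h : ModelRel w q x y) (h' : ModelRel w q y z) :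
    ModelRel w q x z := by
  rcases x with ⟨x, m⟩ | n <;> rcases y with ⟨x', m'⟩ | n' <;> rcases z with ⟨x'', m''⟩ | n'' <;>
    simp only [ModelRel] at h h' ⊢
  · obtain ⟨i, j, rfl, rfl⟩ := h
    obtain ⟨i', j', rfl, rfl⟩ := h'
    exact ⟨i + i', j + j', by ring, by ring⟩
  · obtain ⟨i, rfl⟩ := h
    obtain ⟨i', rfl⟩ := h'
    exact ⟨i + i', by ring⟩

theorem congr {x x' y y' : (ℤ × ℤ) ⊕ ℤ} (h : ModelRel w q x x') (h' : ModelRel w q y y') :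
    ModelRel w q (modelOp x y) (modelOp x' y') := by
  rcases x with ⟨x, m⟩ | n <;> rcases x' with ⟨x', m'⟩ | n' <;> try exact h.elim
  all_goals rcases y with ⟨y, l⟩ | k <;> rcases y' with ⟨y', l'⟩ | k' <;> try exact h'.elim
  all_goals simp only [ModelRel, modelOp] at h h' ⊢
  · obtain ⟨i, j, rfl, rfl⟩ := h
    obtain ⟨i', j', rfl, rfl⟩ := h'
    exact ⟨2 * i - i', 2 * j - j', by ring, by ring⟩
  · obtain ⟨i, j, rfl, rfl⟩ := h
    obtain ⟨i', rfl⟩ := h'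
    exact ⟨i + j - i', by ring⟩
  · obtain ⟨i, rfl⟩ := h
    obtain ⟨i', j', rfl, rfl⟩ := h'
    exact ⟨2 * i - j', 2 * i - i', by ring, by ring⟩
  · obtain ⟨i, rfl⟩ := h
    obtain ⟨i', rfl⟩ := h'
    exact ⟨2 * i - i', by ring⟩

end ModelRel

/-- The setoid given by `ModelRel`. -/
def modelSetoid (w q : ℤ) : Setoid ((ℤ × ℤ) ⊕ ℤ) where
  r := ModelRel w q
  iseqv := ⟨ModelRel.refl, ModelRel.symm, ModelRel.trans⟩

/-- The value in the model of a quandle expression. -/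
def QTerm.eval {A : Type} (c : A → (ℤ × ℤ) ⊕ ℤ) : QTerm A → (ℤ × ℤ) ⊕ ℤ
  | .gen a => c a
  | .act x y => modelOp (x.eval c) (y.eval c)

/-- The quandle axioms hold in the model exactly; only the defining relations need the congruence.
-/
theorem QTerm.Rel.modelRel_eval {A : Type} {R : QTerm A → QTerm A → Prop} {w q : ℤ}
    {c : A → (ℤ × ℤ) ⊕ ℤ} (hc : ∀ x y, R x y → ModelRel w q (x.eval c) (y.eval c)) {x y : QTerm A}
    (h : QTerm.Rel R x y) : ModelRel w q (x.eval c) (y.eval c) := by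
  induction h with
  | of h => exact hc _ _ h
  | refl x => exact ModelRel.refl _
  | symm _ ih => exact ih.symm
  | trans _ _ ih ih' => exact ih.trans ih'
  | congr _ _ ih ih' => exact ih.congr ih'
  | idem x =>
    rw [show QTerm.eval c (.act x x) = modelOp (x.eval c) (x.eval c) from rfl, modelOp_idem]
    exact ModelRel.refl _
  | invol x y =>
    rw [show QTerm.eval c (.act x (.act x y)) = modelOp (x.eval c) (modelOp (x.eval c) (y.eval c))
      from rfl, modelOp_invol]
    exact ModelRel.refl _
  | distrib x y z =>
    have := modelOp_distrib (x.eval c) (y.eval c) (z.eval c)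
    change ModelRel w q (modelOp (x.eval c) (modelOp (y.eval c) (z.eval c)))
      (modelOp (modelOp (x.eval c) (y.eval c)) (modelOp (x.eval c) (z.eval c)))
    rw [this]
    exact ModelRel.refl _

theorem InvQuandle.exists_map_model {A : Type} {R : QTerm A → QTerm A → Prop} {w q : ℤ}
    {c : A → (ℤ × ℤ) ⊕ ℤ} (hc : ∀ x y, R x y → ModelRel w q (x.eval c) (y.eval c)) :
    ∃ Φ : InvQuandle R → Quotient (modelSetoid w q),
      (∀ a, Φ (InvQuandle.gen R a) = Quotient.mk _ (c a)) ∧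
      ∀ x y u v, Φ x = Quotient.mk _ u → Φ y = Quotient.mk _ v →
        Φ (x ◃ y) = Quotient.mk _ (modelOp u v) := by
  refine ⟨Quotient.lift (fun t => Quotient.mk (modelSetoid w q) (t.eval c)) fun s t h =>
    Quotient.sound (QTerm.Rel.modelRel_eval hc h), fun _ => rfl, ?_⟩
  intro x y u v hx hy
  induction x using Quotient.inductionOn
  induction y using Quotient.inductionOn
  exact Quotient.sound (ModelRel.congr (Quotient.exact hx) (Quotient.exact hy))

theorem InvQuandle.induction {A : Type} {R : QTerm A → QTerm A → Prop} {C : InvQuandle R → Prop}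
    (hgen : ∀ a, C (InvQuandle.gen R a)) (hact : ∀ x y, C x → C y → C (x ◃ y))
    (x : InvQuandle R) : C x := by
  induction x using Quotient.inductionOn with
  | h t =>
    induction t with
    | gen a => exact hgen a
    | act s t hs ht => exact hact _ _ hs ht

/-! ## Colourings of the link diagram -/

/-- The colouring of the tangle `1/2` with colours `x` and `y` at the corners `sw` and `ne`. -/
def halfColoring {X : Type} (op : X → X → X) (x y : X) : Tangle.half.data.Arc → X :=
  Sum.elim
    (fun | .nw => op y x | .ne => y | .sw => y | .se => x)
    (fun | .nw => y | .ne => x | .sw => x | .se => op x y)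

theorem isColoring_halfColoring {X : Type} {op : X → X → X} {r : X → X → Prop}
    (hr : ∀ x, r x x) (hop : ∀ x y, op x (op x y) = y) (x y : X) :
    IsColoring op r Tangle.half.data (halfColoring op x y) := by
  refine IsColoring.vsum_iff.2 ⟨IsColoring.pos_iff.2 ⟨hr _, ?_⟩, IsColoring.pos_iff.2 ⟨hr _, hr _⟩,
    hr _, hr _⟩
  change r (op y (op y x)) x
  rw [hop]
  exact hr x

/-- The two overstrands end at `sw` and `ne`, and each is the understrand of the other crossing, so
these two colours determine all others. -/
theorem IsColoring.eq_halfColoring {X : Type} [Rack X] (hX : Rack.IsInvolutory X)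
    {c : Tangle.half.data.Arc → X} (hc : IsColoring (fun x y => x ◃ y) Eq Tangle.half.data c) :
    c = halfColoring (fun x y => x ◃ y) (c (Tangle.half.data.corner .sw))
      (c (Tangle.half.data.corner .ne)) := by
  obtain ⟨h1, h2, e1, e2⟩ := IsColoring.vsum_iff.1 hc
  obtain ⟨e3, e4⟩ := IsColoring.pos_iff.1 h1
  obtain ⟨e5, e6⟩ := IsColoring.pos_iff.1 h2
  have e7 : c (.inr .nw) = c (.inl .ne) := e1.symm.trans e3
  have e8 : c (.inl .se) = c (.inr .sw) := e2.trans e5.symm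
  funext x
  rcases x with (_ | _ | _ | _) | (_ | _ | _ | _)
  · refine (hX.eq_act e4).trans ?_
    exact congrArg₂ (fun x y => x ◃ y) e3 e8
  · rfl
  · exact e3
  · exact e8
  · exact e7
  · exact e5.symm
  · rfl
  · refine e6.symm.trans ?_
    exact congrArg (fun y => c (.inr .sw) ◃ y) e7

theorem Tangle.ClosureRel.isColoring_gen (T : Tangle) :
    IsColoring (fun x y : T.Q₂ => x ◃ y) Eq T.data (InvQuandle.gen T.ClosureRel) :=
  ⟨fun _ _ h => Quotient.sound (.of (.same h)), fun _ _ _ h => Quotient.sound (.of (.crossing h))⟩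

theorem isCoprime_q_w {p q e w : ℤ} (hcop : IsCoprime p q) (hw : w = (e - 1) * q - p) :
    IsCoprime q w := by
  have h : IsCoprime q (-p + q * (e - 1)) := (hcop.symm.neg_right).add_mul_left_right _
  rw [hw]
  convert h using 1; ring

/-- The colouring of the link diagram by the model. -/
theorem exists_map_link_model {p q e w : ℤ} (hcop : IsCoprime p q) (hw : w = (e - 1) * q - p)
    {T : Tangle} {lam : T.data.Arc → ℤ} (hT : T.IsNormalized lam p q) :
    ∃ Φ : (linkDiagram T e).Q₂ → Quotient (modelSetoid w q),
      Φ (linkGen T e .one) = Quotient.mk _ (.inl (0, 0)) ∧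
      Φ (linkGen T e .two) = Quotient.mk _ (.inr 0) ∧
      Φ (linkGen T e .three) = Quotient.mk _ (.inl (0, 1)) ∧
      ∀ x y u v, Φ x = Quotient.mk _ u → Φ y = Quotient.mk _ v →
        Φ (x ◃ y) = Quotient.mk _ (modelOp u v) := by
  obtain ⟨α, β, hαβ⟩ := isCoprime_q_w hcop hw
  have hTw := (Tangle.twist_halfTwists e).exists_isNormalized (ε := 1) rfl
  rw [one_mul, one_mul] at hTw
  obtain ⟨mu, hmu⟩ := hTw
  -- With α q + β w = 1, the index k is q i - w j for i = k α and j = -k β; this is the point (i, 1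
  -- - j) of the relation f (q i - w j) = a i (1 - j).
  let F : ℤ → (ℤ × ℤ) ⊕ ℤ := fun k => .inl (k * α, 1 + k * β)
  have hF : ∀ i j, modelOp (F i) (F j) = F (2 * i - j) := by
    intro i j
    simp only [F, modelOp]
    ring_nf
  let c : (linkDiagram T e).data.Arc → (ℤ × ℤ) ⊕ ℤ :=
    -- The arc joining the tops of the tangles 1/2 has colour x₁ ◃ x₂ = b (-1).
    Sum.elim (halfColoring modelOp (.inl (0, 0)) (.inr (-1)))
      (Sum.elim (halfColoring modelOp (.inr 0) (.inl (0, 1)))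
        (Sum.elim (fun x => F (lam x)) fun x => F (p + q * mu x)))
  have hrefl : ∀ {x y : (ℤ × ℤ) ⊕ ℤ}, x = y → ModelRel w q x y := by
    rintro x _ rfl
    exact ModelRel.refl x
  have hcT : IsColoring modelOp (ModelRel w q) T.data fun x => F (lam x) := by
    refine ⟨fun a b h => hrefl (by simp only [hT.isColoring.1 a b h]), fun o u v h => hrefl ?_⟩
    simp only [hF, ← hT.isColoring.2 o u v h]
  have hcTw : IsColoring modelOp (ModelRel w q) (Tangle.halfTwists e).data
      fun x => F (p + q * mu x) := by
    refine ⟨fun a b h => hrefl (by simp only [hmu.isColoring.1 a b h]), fun o u v h => hrefl ?_⟩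
    simp only [hF, ← hmu.isColoring.2 o u v h]
    congr 1; ring
  have hc : IsColoring modelOp (ModelRel w q) (linkDiagram T e).data c := by
    refine IsColoring.hsum_iff.2 ⟨isColoring_halfColoring ModelRel.refl modelOp_invol _ _,
      IsColoring.hsum_iff.2 ⟨isColoring_halfColoring ModelRel.refl modelOp_invol _ _,
        IsColoring.hsum_iff.2 ⟨hcT, hcTw, ?_, ?_⟩, ?_, ?_⟩, ?_, ?_⟩
    · change ModelRel w q (F (lam (T.data.corner .ne)))
        (F (p + q * mu ((Tangle.halfTwists e).data.corner .nw)))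
      rw [hT.ne, hmu.nw]
      exact hrefl (by congr 1; ring)
    · change ModelRel w q (F (lam (T.data.corner .se)))
        (F (p + q * mu ((Tangle.halfTwists e).data.corner .sw)))
      rw [hT.se, hmu.sw]
      exact hrefl (by congr 1; ring)
    · change ModelRel w q (.inl (0, 1)) (F (lam (T.data.corner .nw)))
      rw [hT.nw]
      exact hrefl (by simp [F])
    · change ModelRel w q (.inl (1, 1)) (F (lam (T.data.corner .sw)))
      rw [hT.sw]
      exact ⟨0, -β, by linear_combination hαβ, by ring⟩
    · exact ModelRel.refl (.inr (-1))
    · exact ModelRel.refl (.inr 0)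
  have hrel : ∀ x y, (linkDiagram T e).ClosureRel x y → ModelRel w q (x.eval c) (y.eval c) := by
    intro x y h
    cases h with
    | same h => exact hc.1 _ _ h
    | crossing h => exact hc.2 _ _ _ h
    | upper =>
      change ModelRel w q (F (p + q * mu ((Tangle.halfTwists e).data.corner .ne))) (.inl (-1, 0))
      rw [hmu.ne]
      refine ⟨0, α - β, ?_, ?_⟩ <;> subst hw
      · linear_combination hαβ
      · linear_combination hαβ
    | lower =>
      change ModelRel w q (F (p + q * mu ((Tangle.halfTwists e).data.corner .se))) (.inl (0, 0))
      rw [hmu.se]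
      refine ⟨0, α, ?_, ?_⟩ <;> subst hw
      · ring
      · linear_combination hαβ
  obtain ⟨Φ, h1, h2⟩ := InvQuandle.exists_map_model hrel
  exact ⟨Φ, h1 _, h1 _, h1 _, h2⟩

/-- The coordinates on the quandle of the link. -/
theorem exists_link_coordinates {p q e w : ℤ} (hq : 0 < q) (hcop : IsCoprime p q)
    (hw : w = (e - 1) * q - p) {T : Tangle} (hT : T.IsRational ((p : ℚ) / q)) :
    ∃ a b, IsCoordinates (linkGen T e .one) (linkGen T e .two) (linkGen T e .three) a b ∧
      (∀ z, (∃ x m, z = a x m) ∨ ∃ n, z = b n) ∧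
      (∀ x m x' m', a x m = a x' m' ↔
        ∃ i j : ℤ, x' = x + (i + j) * w ∧ m' = m + (i - j) * q) ∧
      (∀ n n', b n = b n' ↔ ∃ i : ℤ, n' = n + 2 * w * i) ∧ ∀ x m n, a x m ≠ b n := by
  obtain ⟨lam, hlam⟩ := hT.exists_isNormalized hq hcop
  have hTw := (Tangle.twist_halfTwists e).exists_isNormalized (ε := 1) rfl
  rw [one_mul, one_mul] at hTw
  obtain ⟨mu, hmu⟩ := hTw
  have hQ : Rack.IsInvolutory (linkDiagram T e).Q₂ := InvQuandle.isInvolutory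
  let g := InvQuandle.gen (linkDiagram T e).ClosureRel
  obtain ⟨c1, cr, g1, g2⟩ := IsColoring.hsum_iff.1
    (Tangle.ClosureRel.isColoring_gen (linkDiagram T e))
  obtain ⟨c2, cr, g3, g4⟩ := IsColoring.hsum_iff.1 cr
  obtain ⟨c3, c4, g5, g6⟩ := IsColoring.hsum_iff.1 cr
  have upper : g (.inr (.inr (.inr ((Tangle.halfTwists e).data.corner .ne)))) =
      g (.inl (Tangle.half.data.corner .nw)) :=
    Quotient.sound (.of .upper)
  have lower : g (.inr (.inr (.inr ((Tangle.halfTwists e).data.corner .se)))) =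
      linkGen T e .one :=
    Quotient.sound (.of .lower)
  have d1 := fun x => congrFun (c1.eq_halfColoring hQ) x
  have d2 := fun x => congrFun (c2.eq_halfColoring hQ) x
  obtain ⟨f, hf, hfc⟩ := hlam.exists_hom _ hQ _ c3
  obtain ⟨k, hk, hkc⟩ := hmu.exists_hom _ hQ _ c4
  set x₁ := linkGen T e .one with hx₁
  set x₂ := linkGen T e .two with hx₂
  set x₃ := linkGen T e .three with hx₃
  set y := g (.inl (Tangle.half.data.corner .ne)) with hy
  change ∀ x, g (.inl x) = halfColoring (fun x y => x ◃ y) x₁ y x at d1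
  have hsw : g (.inr (.inl (Tangle.half.data.corner .sw))) = x₂ := g2.symm
  change ∀ x, g (.inr (.inl x)) = halfColoring (fun x y => x ◃ y)
    (g (.inr (.inl (Tangle.half.data.corner .sw)))) x₃ x at d2
  rw [hsw] at d2
  have hy2 : x₂ = x₁ ◃ y := d1 (Tangle.half.data.corner .se)
  have hy1 : y = x₁ ◃ x₂ := hQ.eq_act hy2.symm
  have hy3 : y = x₃ ◃ x₂ := g1.trans (d2 (Tangle.half.data.corner .nw))
  obtain ⟨a, b, hab⟩ := exists_isCoordinates hQ (hy1.symm.trans hy3)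
  have f0 : f 0 = x₃ := by rw [← hlam.nw, ← hfc]; exact g3.symm
  have fq : f q = x₂ ◃ x₃ := by
    rw [← hlam.sw, ← hfc]
    exact g4.symm.trans (d2 (Tangle.half.data.corner .se))
  -- The ends shared by p/q and the half-twists carry f p and f (p + q), two consecutive values of
  -- the right-hand side.
  have kf : ∀ n, k n = f (p + q * n) := by
    refine hk.ext_of_eq (hf.comp_affine p q) 0 ?_ ?_
    · rw [mul_zero, add_zero, ← hlam.ne, ← hfc, ← hmu.nw, ← hkc]
      exact g5.symm
    · rw [zero_add, mul_one, ← hlam.se, ← hfc, ← hmu.sw, ← hkc]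
      exact g6.symm
  -- The half-twists have slope -e / 1, so their lower and upper right ends are k (1 - e) and k
  -- (-e). This is the origin of w.
  have fw : f (-w) = x₁ := by
    rw [show -w = p + q * (-e + 1) by rw [hw]; ring, ← kf, ← hmu.se, ← hkc]
    exact lower
  have fwq : f (-w - q) = x₁ ◃ (x₂ ◃ x₁) := by
    rw [show -w - q = p + q * (-e) by rw [hw]; ring, ← kf, ← hmu.ne, ← hkc]
    refine upper.trans ((d1 (Tangle.half.data.corner .nw)).trans ?_)
    change y ◃ x₁ = _
    nth_rewrite 1 [hy1]
    rw [IsCoordinates.act_act hQ, Quandle.fix]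
  have hfa : ∀ i j, f (q * i - w * j) = a i (1 - j) := by
    refine hab.dihedralHom_eq hQ hf (f0.trans hab.a_zero_one.symm) ?_
      (fw.trans hab.a_zero_zero.symm) ?_
    · rw [fq, ← hab.a_zero_one, hab.two_a]; rfl
    · have := hab.two_a 0 0
      rw [hab.a_zero_zero] at this
      rw [fwq, this, hab.one_a]; rfl
  obtain ⟨α, β, hαβ⟩ := isCoprime_q_w hcop hw
  -- Coprimality of q and w puts every colour of p/q and of the half-twists among the a's.
  have fa : ∀ n, ∃ x m, f n = a x m := by
    intro n
    refine ⟨n * α, 1 + n * β, ?_⟩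
    have := hfa (n * α) (-(n * β))
    rw [sub_neg_eq_add] at this
    rw [← this]
    congr 1
    linear_combination -n * hαβ
  have hact : ∀ z z' : (linkDiagram T e).Q₂, ((∃ x m, z = a x m) ∨ ∃ n, z = b n) →
      ((∃ x m, z' = a x m) ∨ ∃ n, z' = b n) → (∃ x m, z ◃ z' = a x m) ∨ ∃ n, z ◃ z' = b n := by
    rintro _ _ (⟨x, m, rfl⟩ | ⟨n, rfl⟩) (⟨x', m', rfl⟩ | ⟨n', rfl⟩)
    · exact .inl ⟨_, _, (hab.a_act hQ x m).1 x' m'⟩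
    · exact .inr ⟨_, (hab.a_act hQ x m).2 n'⟩
    · exact .inl ⟨_, _, (hab.b_act hQ n).1 x' m'⟩
    · exact .inr ⟨_, (hab.b_act hQ n).2 n'⟩
  have s₁ : (∃ x m, x₁ = a x m) ∨ ∃ n, x₁ = b n := .inl ⟨_, _, hab.a_zero_zero.symm⟩
  have s₂ : (∃ x m, x₂ = a x m) ∨ ∃ n, x₂ = b n := .inr ⟨_, hab.b_zero.symm⟩
  have s₃ : (∃ x m, x₃ = a x m) ∨ ∃ n, x₃ = b n := .inl ⟨_, _, hab.a_zero_one.symm⟩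
  have sy : (∃ x m, y = a x m) ∨ ∃ n, y = b n := by
    rw [hy1]
    exact hact _ _ s₁ s₂
  have surj : ∀ z, (∃ x m, z = a x m) ∨ ∃ n, z = b n := by
    refine InvQuandle.induction ?_ hact
    rintro (x | x | x | x)
    · rw [show InvQuandle.gen (linkDiagram T e).ClosureRel (.inl x) = _ from d1 x]
      rcases x with (_ | _ | _ | _) | (_ | _ | _ | _)
      exacts [hact _ _ sy s₁, sy, sy, s₁, sy, s₁, s₁, hact _ _ s₁ sy]
    · rw [show InvQuandle.gen (linkDiagram T e).ClosureRel (.inr (.inl x)) = _ from d2 x]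
      rcases x with (_ | _ | _ | _) | (_ | _ | _ | _)
      exacts [hact _ _ s₃ s₂, s₃, s₃, s₂, s₃, s₂, s₂, hact _ _ s₂ s₃]
    · rw [show InvQuandle.gen (linkDiagram T e).ClosureRel (.inr (.inr (.inl x))) = _ from hfc x]
      exact .inl (fa _)
    · rw [show InvQuandle.gen (linkDiagram T e).ClosureRel (.inr (.inr (.inr x))) = _ from
        (hkc x).trans (kf _)]
      exact .inl (fa _)
  -- The map to the model recovers the coordinates modulo the periods, so nothing else is
  -- identified.
  obtain ⟨Φ, Φ1, Φ2, Φ3, hΦ⟩ := exists_map_link_model (e := e) hcop hw hlam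
  have Φa : ∀ x m, Φ (a x m) = Quotient.mk _ (.inl (x, m)) := by
    intro x m
    induction x, m using int_pair_induction with
    | h0 => rw [hab.a_zero_zero]; exact Φ1
    | h1 => rw [hab.a_zero_one]; exact Φ3
    | s1 x m ih =>
      rw [← hab.one_a, hΦ _ _ _ _ Φ1 ih]
      simp [modelOp]
    | s2 x m ih =>
      rw [← hab.two_a, hΦ _ _ _ _ Φ2 ih]
      simp [modelOp]
    | s3 x m ih =>
      rw [← hab.three_a, hΦ _ _ _ _ Φ3 ih]
      simp [modelOp]
  have Φb : ∀ n, Φ (b n) = Quotient.mk _ (.inr n) := by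
    intro n
    induction n using int_reflection_induction with
    | h0 => rw [hab.b_zero]; exact Φ2
    | s1 n ih =>
      rw [← hab.one_b, hΦ _ _ _ _ Φ1 ih]
      simp only [modelOp]
      congr 2; ring
    | s2 n ih =>
      rw [← hab.two_b, hΦ _ _ _ _ Φ2 ih]
      simp [modelOp]
  refine ⟨a, b, hab, surj, fun x m x' m' => ⟨fun h => ?_, ?_⟩, fun n n' => ⟨fun h => ?_, ?_⟩,
    fun x m n h => ?_⟩
  · have h := congrArg Φ h
    rw [Φa, Φa] at h
    exact Quotient.exact h
  · rintro ⟨i, j, rfl, rfl⟩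
    exact (hab.a_eq_of_dihedralHom hfa x m i j).symm
  · have h := congrArg Φ h
    rw [Φb, Φb] at h
    exact Quotient.exact h
  · rintro ⟨i, rfl⟩
    exact (hab.b_eq_of_dihedralHom hQ hfa n i).symm
  · have h := congrArg Φ h
    rw [Φa, Φb] at h
    exact Quotient.exact h

/-! ## The tile graph -/

theorem isTileVertex_iff {v : ℤ × ℤ} : IsTileVertex v ↔ v.2 % 2 = 1 := by
  obtain ⟨x, y⟩ := v
  constructor
  · rintro ⟨m, n, h, hv⟩
    simp only [tileVertices, Set.mem_insert_iff, Set.mem_singleton_iff, Prod.ext_iff, Prod.fst_sub,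
      Prod.snd_sub, Int.ModEq] at h hv ⊢
    omega
  · intro h
    refine ⟨x, y - (y - 2 * x) % 4, ?_, ?_⟩
    · simp only [Int.ModEq]; omega
    · simp only [tileVertices, Set.mem_insert_iff, Set.mem_singleton_iff, Prod.ext_iff, Prod.fst_sub,
        Prod.snd_sub] at h ⊢
      omega

/-- The other end of the edge with a given label at a given vertex of `𝒯`. -/
def tileStep : Gen → ℤ × ℤ → ℤ × ℤ
  | .one, v => if v.2 % 4 = 1 then (v.1, v.2 - 2) else (v.1, v.2 + 2)
  | .two, v => if (v.2 - 2 * v.1) % 4 = 1 then (v.1 + 1, v.2) else (v.1 - 1, v.2)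
  | .three, v => if v.2 % 4 = 3 then (v.1, v.2 - 2) else (v.1, v.2 + 2)

theorem tileStep_odd {l : Gen} {v : ℤ × ℤ} (h : v.2 % 2 = 1) : (tileStep l v).2 % 2 = 1 := by
  cases l <;> simp only [tileStep] <;> split_ifs <;> simp only <;> omega

theorem isTileEdge_iff {u v : ℤ × ℤ} : IsTileEdge u v ↔ u.2 % 2 = 1 ∧
    ((u.1 = v.1 ∧ (u.2 = v.2 + 2 ∨ v.2 = u.2 + 2)) ∨
      (u.2 = v.2 ∧ ((v.1 = u.1 + 1 ∧ (u.2 - 2 * u.1) % 4 = 1) ∨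
        (u.1 = v.1 + 1 ∧ (u.2 - 2 * v.1) % 4 = 1)))) := by
  obtain ⟨x, y⟩ := u
  obtain ⟨x', y'⟩ := v
  simp only [IsTileEdge, tileEdges, Set.mem_insert_iff, Set.mem_singleton_iff, Sym2.eq_iff,
    Prod.ext_iff, Prod.fst_sub, Prod.snd_sub, Int.ModEq]
  constructor
  · rintro ⟨m, n, h, hv⟩
    rcases hv with (hv | hv) | (hv | hv) | (hv | hv) | (hv | hv) | (hv | hv) | (hv | hv) <;>
      refine ⟨by omega, ?_⟩ <;>
      first
        | exact .inl ⟨by omega, by omega⟩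
        | exact .inr ⟨by omega, .inl ⟨by omega, by omega⟩⟩
        | exact .inr ⟨by omega, .inr ⟨by omega, by omega⟩⟩
  · rintro ⟨ho, ⟨rfl, rfl | rfl⟩ | ⟨rfl, ⟨rfl, h⟩ | ⟨rfl, h⟩⟩⟩
    · by_cases h : (y' - 1 - 2 * x) % 4 = 0
      · exact ⟨x, y' - 1, by omega, .inl (.inr (by omega))⟩
      · exact ⟨x, y' - 3, by omega, .inr (.inl (.inr (by omega)))⟩
    · by_cases h : (y - 1 - 2 * x) % 4 = 0
      · exact ⟨x, y - 1, by omega, .inl (.inl (by omega))⟩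
      · exact ⟨x, y - 3, by omega, .inr (.inl (.inl (by omega)))⟩
    · exact ⟨x, y - 1, by omega, .inr (.inr (.inr (.inr (.inr (.inr (by omega))))))⟩
    · exact ⟨x', y - 1, by omega, .inr (.inr (.inr (.inr (.inr (.inl (by omega))))))⟩

theorem tileGraph_adj_iff {l : Gen} {u v : tileGraph.V} :
    tileGraph.Adj l u v ↔ v.1 = tileStep l u.1 := by
  obtain ⟨⟨x, y⟩, hu⟩ := u
  obtain ⟨⟨x', y'⟩, hv⟩ := v
  rw [isTileVertex_iff] at hu hv
  change IsTileEdge (x, y) (x', y') ∧ HasTileLabel l (x, y) (x', y') ↔ (x', y') = tileStep l (x, y)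
  rw [isTileEdge_iff]
  simp only at hu hv
  cases l <;> simp only [HasTileLabel, tileStep, Int.ModEq] <;> split_ifs <;>
    simp only [Prod.ext_iff] <;> omega

theorem tile_induction {C : ℤ × ℤ → Prop} (h0 : C (0, 1))
    (hstep : ∀ l v, v.2 % 2 = 1 → C v → C (tileStep l v)) {v : ℤ × ℤ} (hv : v.2 % 2 = 1) : C v := by
  have up : ∀ x y : ℤ, y % 2 = 1 → C (x, y) → C (x, y + 2) := by
    intro x y hy h
    by_cases h4 : y % 4 = 1
    · simpa [tileStep, h4] using hstep .three _ hy h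
    · simpa [tileStep, h4] using hstep .one _ hy h
  have down : ∀ x y : ℤ, y % 2 = 1 → C (x, y) → C (x, y - 2) := by
    intro x y hy h
    by_cases h4 : y % 4 = 1
    · simpa [tileStep, h4] using hstep .one _ hy h
    · have h4' : y % 4 = 3 := by omega
      simpa [tileStep, h4'] using hstep .three _ hy h
  have vert : ∀ x y : ℤ, y % 2 = 1 → C (x, y) → ∀ k : ℤ, C (x, y + 2 * k) := by
    intro x y hy h k
    induction k using Int.induction_on with
    | zero => simpa using h
    | succ n ih =>
      convert up _ _ (by omega) ih using 2; ring
    | pred n ih =>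
      convert down _ _ (by omega) ih using 2; ring
  have all : ∀ x y y' : ℤ, y % 2 = 1 → y' % 2 = 1 → C (x, y) → C (x, y') := by
    intro x y y' hy hy' h
    convert vert x y hy h ((y' - y) / 2) using 2
    omega
  have horiz : ∀ x : ℤ, C (x, 1) := by
    intro x
    induction x using Int.induction_on with
    | zero => exact h0
    | succ n ih =>
      -- Horizontal edges leave alternate vertices of a column to the right and to the left. The
      -- heights 2n + 1 here and 2n + 3 below select the wanted direction.
      have h := hstep .two (n, 2 * n + 1) (by simp only; omega) (all _ _ _ rfl (by omega) ih)
      rw [tileStep, if_pos (by simp only; omega)] at h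
      exact all _ _ _ (by simp only; omega) rfl h
    | pred n ih =>
      have h := hstep .two (-n, 2 * n + 3) (by simp only; omega) (all _ _ _ rfl (by omega) ih)
      rw [tileStep, if_neg (by simp only; omega)] at h
      exact all _ _ _ (by simp only; omega) rfl h
  exact all v.1 1 v.2 rfl hv (horiz _)

/-! ## Isomorphisms of labelled graphs -/

namespace LabeledGraph

variable {Λ : Type}

theorem pointedIso_of_surjective {G H : LabeledGraph Λ} {Z : Type} {α : Z → G.V} {β : Z → H.V}
    (hα : Function.Surjective α) (hβ : Function.Surjective β) (h : ∀ u v, α u = α v ↔ β u = β v)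
    (hadj : ∀ l u v, G.Adj l (α u) (α v) ↔ H.Adj l (β u) (β v)) (z : Z) :
    G.PointedIso (α z) H (β z) := by
  have key : ∀ u, β (Function.surjInv hα (α u)) = β u := fun u =>
    (h _ _).1 (Function.surjInv_eq hα _)
  have hbij : Function.Bijective fun g => β (Function.surjInv hα g) := by
    refine ⟨fun g g' hg => ?_, fun k => ?_⟩
    · have := (h _ _).2 hg
      rwa [Function.surjInv_eq hα, Function.surjInv_eq hα] at this
    · obtain ⟨u, rfl⟩ := hβ k
      exact ⟨α u, key u⟩
  refine ⟨Equiv.ofBijective _ hbij, fun l u v => ?_, key z⟩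
  obtain ⟨u, rfl⟩ := hα u
  obtain ⟨v, rfl⟩ := hα v
  simp only [Equiv.ofBijective_apply, key]
  exact hadj l u v

theorem component_eq_of_mem {G : LabeledGraph Λ} {u v : G.V} (h : u ∈ G.component v) :
    G.component u = G.component v := by
  have : Std.Symm fun a b => ∃ l, G.Adj l a b := ⟨fun a b ⟨l, hl⟩ => ⟨l, G.symm l a b hl⟩⟩
  have symm := Relation.ReflTransGen.stdSymm (r := fun a b => ∃ l, G.Adj l a b)
  ext z
  exact ⟨fun hz => Relation.ReflTransGen.trans h hz, fun hz => (symm.symm _ _ h).trans hz⟩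

theorem component_subset {G : LabeledGraph Λ} {v : G.V} {C : Set G.V} (hv : v ∈ C)
    (hC : ∀ l x y, G.Adj l x y → x ∈ C → y ∈ C) : G.component v ⊆ C := by
  intro z hz
  induction hz with
  | refl => exact hv
  | tail _ h ih =>
    obtain ⟨l, hl⟩ := h
    exact hC l _ _ hl ih

theorem mem_component_of_adj {G : LabeledGraph Λ} {l : Λ} {u v x : G.V} (h : G.Adj l u v)
    (hu : u ∈ G.component x) : v ∈ G.component x :=
  Relation.ReflTransGen.tail hu ⟨l, h⟩

end LabeledGraph

/-- Every vertex of 𝒯 has exactly one edge of each label, and 𝒯 is connected. So a map turning steps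
into actions is onto the component of its base value and carries edges to edges; the component is 𝒯
modulo its fibres. -/
theorem componentIsTileQuotient_of_kernel {T : Tangle} {e : ℤ} {i : Gen}
    {S : Set (Equiv.Perm (ℤ × ℤ))} {θ : ℤ × ℤ → (linkDiagram T e).Q₂} (h0 : θ (0, 1) = linkGen T e i)
    (hstep : ∀ l v, v.2 % 2 = 1 → θ (tileStep l v) = linkGen T e l ◃ θ v)
    (hker : ∀ u v : ℤ × ℤ, u.2 % 2 = 1 → v.2 % 2 = 1 →
      (θ u = θ v ↔ ∃ g ∈ Subgroup.closure S, g u = v)) : ComponentIsTileQuotient T e i S := by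
  have hmem : ∀ v : tileGraph.V, θ v.1 ∈ (cayleyGraph T e).component (linkGen T e i) := fun v => by
    refine tile_induction (C := fun v => θ v ∈ (cayleyGraph T e).component (linkGen T e i)) ?_ ?_
      (isTileVertex_iff.1 v.2)
    · rw [h0]
      exact Relation.ReflTransGen.refl
    · intro l v hv h
      exact LabeledGraph.mem_component_of_adj (l := l) (hstep l v hv).symm h
  have hsub : (cayleyGraph T e).component (linkGen T e i) ⊆ {z | ∃ v : tileGraph.V, θ v.1 = z} := by
    refine LabeledGraph.component_subset ⟨tileBase, h0⟩ ?_
    rintro l x _ rfl ⟨v, rfl⟩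
    have hv := isTileVertex_iff.1 v.2
    exact ⟨⟨tileStep l v.1, isTileVertex_iff.2 (tileStep_odd hv)⟩, hstep l _ hv⟩
  have hbase : (cayleyGraph T e).base (linkGen T e i) = ⟨θ tileBase.1, hmem tileBase⟩ :=
    Subtype.ext h0.symm
  have hk : ∀ u v : tileGraph.V, θ u.1 = θ v.1 ↔
      Quotient.mk (tileSetoid (Subgroup.closure S)) u = Quotient.mk _ v := fun u v =>
    (hker _ _ (isTileVertex_iff.1 u.2) (isTileVertex_iff.1 v.2)).trans
      (Quotient.eq (r := tileSetoid (Subgroup.closure S))).symm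
  unfold ComponentIsTileQuotient
  rw [hbase]
  refine LabeledGraph.pointedIso_of_surjective
    (G := (cayleyGraph T e).componentGraph (linkGen T e i)) (H := tileQuotient S)
    (α := fun v : tileGraph.V => ⟨θ v.1, hmem v⟩)
    (β := Quotient.mk (tileSetoid (Subgroup.closure S))) ?_ Quotient.mk_surjective ?_ ?_ tileBase
  · rintro ⟨z, hz⟩
    obtain ⟨v, rfl⟩ := hsub hz
    exact ⟨v, rfl⟩
  · intro u v
    exact Subtype.ext_iff.trans (hk u v)
  · intro l u v
    change linkGen T e l ◃ θ u.1 = θ v.1 ↔ ∃ u' v' : tileGraph.V, _ = _ ∧ _ = _ ∧ _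
    constructor
    · intro h
      have hu := isTileVertex_iff.1 u.2
      refine ⟨u, ⟨tileStep l u.1, isTileVertex_iff.2 (tileStep_odd hu)⟩, rfl, ?_,
        tileGraph_adj_iff.2 rfl⟩
      exact (hk _ _).1 ((hstep l _ hu).trans h)
    · rintro ⟨u', v', hu, hv, h⟩
      replace hu := (hk _ _).2 hu
      replace hv := (hk _ _).2 hv
      rw [tileGraph_adj_iff] at h
      rw [← hu, ← hv, h, hstep l _ (isTileVertex_iff.1 u'.2)]

/-! ## Groups generated by symmetries of the tile graph -/

/-- Invariance is only available at vertices of 𝒯, that is, at odd height. Preservation of odd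
height is carried through the induction as an equivalence so that inverses can be treated. -/
theorem closure_invariant {X : Type} {S : Set (Equiv.Perm (ℤ × ℤ))} {θ : ℤ × ℤ → X}
    (hodd : ∀ g ∈ S, ∀ u, (g u).2 % 2 = 1 ↔ u.2 % 2 = 1)
    (hθ : ∀ g ∈ S, ∀ u, u.2 % 2 = 1 → θ (g u) = θ u) {g : Equiv.Perm (ℤ × ℤ)}
    (hg : g ∈ Subgroup.closure S) {u : ℤ × ℤ} (hu : u.2 % 2 = 1) : θ (g u) = θ u := by
  have : ∀ u, ((g u).2 % 2 = 1 ↔ u.2 % 2 = 1) ∧ (u.2 % 2 = 1 → θ (g u) = θ u) := by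
    induction hg using Subgroup.closure_induction with
    | mem g hg => exact fun u => ⟨hodd g hg u, hθ g hg u⟩
    | one => exact fun u => ⟨Iff.rfl, fun _ => rfl⟩
    | mul g k _ _ ihg ihk =>
      exact fun u => ⟨(ihg _).1.trans (ihk u).1, fun h =>
        ((ihg _).2 ((ihk u).1.2 h)).trans ((ihk u).2 h)⟩
    | inv g _ ih =>
      intro u
      have h := ih (g⁻¹ u)
      rw [← Equiv.Perm.mul_apply, mul_inv_cancel, Equiv.Perm.one_apply] at h
      exact ⟨h.1.symm, fun hu => (h.2 (h.1.1 hu)).symm⟩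
  exact (this u).2 hu

theorem tileTrans_mul (a b c d : ℤ) :
    tileTrans a b * tileTrans c d = tileTrans (a + c) (b + d) := by
  ext v <;> simp [tileTrans] <;> ring

theorem tileTrans_zpow (a b n : ℤ) : tileTrans a b ^ n = tileTrans (a * n) (b * n) := by
  have h0 : tileTrans 0 0 = 1 := by ext v <;> simp [tileTrans]
  have hinv : (tileTrans a b)⁻¹ = tileTrans (-a) (-b) := by
    rw [inv_eq_iff_mul_eq_one, tileTrans_mul, add_neg_cancel, add_neg_cancel, h0]
  induction n using Int.induction_on with
  | zero => simp [h0]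
  | succ n ih => rw [zpow_add_one, ih, tileTrans_mul]; congr 1 <;> ring
  | pred n ih => rw [zpow_sub_one, ih, hinv, tileTrans_mul]; congr 1 <;> ring

theorem tileTrans_mem {H : Subgroup (Equiv.Perm (ℤ × ℤ))} {c d : ℤ} (hc : tileTrans c 0 ∈ H)
    (hd : tileTrans 0 d ∈ H) (i j : ℤ) : tileTrans (c * i) (d * j) ∈ H := by
  have h := H.mul_mem (H.zpow_mem hc i) (H.zpow_mem hd j)
  rw [tileTrans_zpow, tileTrans_zpow] at h
  rwa [tileTrans_mul, zero_mul, zero_mul, add_zero, zero_add] at h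

/-! ## The orbit maps from the tile graph to the quandle -/

/-- The map from the vertices of `𝒯` which takes `(0, 1)` to `a 0 t`. -/
def rotOrbit {Q : Type} (a : ℤ → ℤ → Q) (t : ℤ) (v : ℤ × ℤ) : Q :=
  if v.2 % 4 = 1 then
    if v.1 % 2 = 0 then a (-v.1) (t - (v.2 - 1) / 2) else a v.1 (t - (v.2 - 1) / 2)
  else
    if v.1 % 2 = 0 then a v.1 ((v.2 + 1) / 2 - t) else a (-v.1) ((v.2 + 1) / 2 - t)

/-- The map from the vertices of `𝒯` which takes `(0, 1)` to `b 0`. -/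
def reflOrbit {Q : Type} (b : ℤ → Q) (v : ℤ × ℤ) : Q :=
  if (v.2 - 2 * v.1) % 4 = 1 then b (-v.1) else b (v.1 - 1)

/-- Each step reverses the sign with which the abscissa enters: a vertical one changes the height
mod 4, a horizontal one the parity of the abscissa. This matches x ↦ -x for s₁, s₃ and x ↦ 1 - x for
s₂. -/
theorem IsCoordinates.rotOrbit_step {Q : Type} [Quandle Q] {x : Gen → Q} {a : ℤ → ℤ → Q}
    {b : ℤ → Q} (h : IsCoordinates (x .one) (x .two) (x .three) a b) (t : ℤ) (l : Gen) (v : ℤ × ℤ)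
    (hv : v.2 % 2 = 1) : rotOrbit a t (tileStep l v) = x l ◃ rotOrbit a t v := by
  obtain ⟨X, Y⟩ := v
  simp only at hv
  cases l <;> simp only [tileStep] <;> split_ifs <;> simp only [rotOrbit] <;> split_ifs <;>
    first
      | omega
      | (simp only [h.one_a, h.two_a, h.three_a]; refine congrArg₂ a ?_ ?_ <;> omega)

theorem IsCoordinates.reflOrbit_step {Q : Type} [Quandle Q] {x : Gen → Q} {a : ℤ → ℤ → Q}
    {b : ℤ → Q} (h : IsCoordinates (x .one) (x .two) (x .three) a b) (l : Gen) (v : ℤ × ℤ)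
    (hv : v.2 % 2 = 1) : reflOrbit b (tileStep l v) = x l ◃ reflOrbit b v := by
  obtain ⟨X, Y⟩ := v
  simp only at hv
  cases l <;> simp only [tileStep] <;> split_ifs <;> simp only [reflOrbit] <;> split_ifs <;>
    first
      | omega
      | (simp only [h.one_b, h.two_b, h.three_b]; try (refine congrArg b ?_; omega))

theorem tileRot_apply (a b x y : ℤ) : tileRot a b (x, y) = (2 * a - x, 2 * b - y) := rfl

theorem tileRefl_apply (k x y : ℤ) : tileRefl k (x, y) = (k - x, y) := rfl

theorem tileTrans_apply (a b x y : ℤ) : tileTrans a b (x, y) = (x + a, y + b) := rfl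

theorem tileGlide_apply (b k x y : ℤ) : tileGlide b k (x, y) = (k - x + 0, y + b) := rfl

/-! ### Fibres of the orbit maps as orbits of symmetry groups -/

section Kernels

variable {Q : Type} {a : ℤ → ℤ → Q} {b : ℤ → Q} {w q : ℤ}

theorem rotOrbit_one_even (t : ℤ) {x y : ℤ} (hy : y % 4 = 1) (hx : x % 2 = 0) :
    rotOrbit a t (x, y) = a (-x) (t - (y - 1) / 2) := by
  rw [rotOrbit, if_pos hy, if_pos hx]

theorem rotOrbit_one_odd (t : ℤ) {x y : ℤ} (hy : y % 4 = 1) (hx : x % 2 = 1) :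
    rotOrbit a t (x, y) = a x (t - (y - 1) / 2) := by
  rw [rotOrbit, if_pos hy, if_neg (by simp only; omega)]

theorem rotOrbit_three_even (t : ℤ) {x y : ℤ} (hy : y % 4 = 3) (hx : x % 2 = 0) :
    rotOrbit a t (x, y) = a x ((y + 1) / 2 - t) := by
  rw [rotOrbit, if_neg (by simp only; omega), if_pos hx]

theorem rotOrbit_three_odd (t : ℤ) {x y : ℤ} (hy : y % 4 = 3) (hx : x % 2 = 1) :
    rotOrbit a t (x, y) = a (-x) ((y + 1) / 2 - t) := by
  rw [rotOrbit, if_neg (by simp only; omega), if_neg (by simp only; omega)]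

/-- No period of `a` is involved: for t = 0 and t = 1 this symmetry expresses that x₁ and x₃ fix
themselves. -/
theorem rotOrbit_rot_zero (t : ℤ) {v : ℤ × ℤ} (hv : v.2 % 2 = 1) :
    rotOrbit a t (tileRot 0 (2 * t) v) = rotOrbit a t v := by
  obtain ⟨x, y⟩ := v
  simp only at hv
  rw [tileRot_apply]
  have h4 : y % 4 = 1 ∨ y % 4 = 3 := by omega
  rcases h4 with hy | hy <;> rcases Int.emod_two_eq_zero_or_one x with hx | hx
  · rw [rotOrbit_one_even t hy hx, rotOrbit_three_even t (by omega) (by omega)]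
    refine congrArg₂ a ?_ ?_ <;> omega
  · rw [rotOrbit_one_odd t hy hx, rotOrbit_three_odd t (by omega) (by omega)]
    refine congrArg₂ a ?_ ?_ <;> omega
  · rw [rotOrbit_three_even t hy hx, rotOrbit_one_even t (by omega) (by omega)]
    refine congrArg₂ a ?_ ?_ <;> omega
  · rw [rotOrbit_three_odd t hy hx, rotOrbit_one_odd t (by omega) (by omega)]
    refine congrArg₂ a ?_ ?_ <;> omega

theorem reflOrbit_pos {x y : ℤ} (h : (y - 2 * x) % 4 = 1) : reflOrbit b (x, y) = b (-x) := by
  rw [reflOrbit, if_pos h]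

theorem reflOrbit_neg {x y : ℤ} (h : (y - 2 * x) % 4 = 3) : reflOrbit b (x, y) = b (x - 1) := by
  rw [reflOrbit, if_neg (by simp only; omega)]

section

variable (ha : ∀ x m x' m', a x m = a x' m' ↔
  ∃ i j : ℤ, x' = x + (i + j) * w ∧ m' = m + (i - j) * q)

include ha

theorem rotOrbit_rot_vertical (t : ℤ) {v : ℤ × ℤ} (hv : v.2 % 2 = 1) :
    rotOrbit a t (tileRot 0 (2 * t + 2 * q) v) = rotOrbit a t v := by
  obtain ⟨x, y⟩ := v
  simp only at hv
  rw [tileRot_apply]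
  have h4 : y % 4 = 1 ∨ y % 4 = 3 := by omega
  rcases h4 with hy | hy <;> rcases Int.emod_two_eq_zero_or_one x with hx | hx
  · rw [rotOrbit_one_even t hy hx, rotOrbit_three_even t (by omega) (by omega), ha]
    exact ⟨-1, 1, by omega, by omega⟩
  · rw [rotOrbit_one_odd t hy hx, rotOrbit_three_odd t (by omega) (by omega), ha]
    exact ⟨-1, 1, by omega, by omega⟩
  · rw [rotOrbit_three_even t hy hx, rotOrbit_one_even t (by omega) (by omega), ha]
    exact ⟨1, -1, by omega, by omega⟩
  · rw [rotOrbit_three_odd t hy hx, rotOrbit_one_odd t (by omega) (by omega), ha]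
    exact ⟨1, -1, by omega, by omega⟩

theorem rotOrbit_rot_horizontal {v : ℤ × ℤ} (hv : v.2 % 2 = 1) :
    rotOrbit a 0 (tileRot w 0 v) = rotOrbit a 0 v := by
  obtain ⟨x, y⟩ := v
  simp only at hv
  rw [tileRot_apply]
  have h4 : y % 4 = 1 ∨ y % 4 = 3 := by omega
  rcases h4 with hy | hy <;> rcases Int.emod_two_eq_zero_or_one x with hx | hx
  · rw [rotOrbit_one_even 0 hy hx, rotOrbit_three_even 0 (by omega) (by omega), ha]
    exact ⟨-1, -1, by omega, by omega⟩
  · rw [rotOrbit_one_odd 0 hy hx, rotOrbit_three_odd 0 (by omega) (by omega), ha]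
    exact ⟨1, 1, by omega, by omega⟩
  · rw [rotOrbit_three_even 0 hy hx, rotOrbit_one_even 0 (by omega) (by omega), ha]
    exact ⟨1, 1, by omega, by omega⟩
  · rw [rotOrbit_three_odd 0 hy hx, rotOrbit_one_odd 0 (by omega) (by omega), ha]
    exact ⟨-1, -1, by omega, by omega⟩

/-- For even q the period (±w, ±q) keeps the height mod 4, while odd w changes the parity of the
abscissa and with it the sign in `rotOrbit`. Hence it appears on 𝒯 as a glide reflection and not as
a translation. -/
theorem rotOrbit_glide (t : ℤ) (hq : q % 2 = 0) (hw : w % 2 = 1) {v : ℤ × ℤ} (hv : v.2 % 2 = 1) :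
    rotOrbit a t (tileGlide (2 * q) w v) = rotOrbit a t v := by
  obtain ⟨x, y⟩ := v
  simp only at hv
  rw [tileGlide_apply]
  have h4 : y % 4 = 1 ∨ y % 4 = 3 := by omega
  rcases h4 with hy | hy <;> rcases Int.emod_two_eq_zero_or_one x with hx | hx
  · rw [rotOrbit_one_even t hy hx, rotOrbit_one_odd t (by omega) (by omega), ha]
    exact ⟨0, -1, by omega, by omega⟩
  · rw [rotOrbit_one_odd t hy hx, rotOrbit_one_even t (by omega) (by omega), ha]
    exact ⟨1, 0, by omega, by omega⟩
  · rw [rotOrbit_three_even t hy hx, rotOrbit_three_odd t (by omega) (by omega), ha]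
    exact ⟨0, 1, by omega, by omega⟩
  · rw [rotOrbit_three_odd t hy hx, rotOrbit_three_even t (by omega) (by omega), ha]
    exact ⟨-1, 0, by omega, by omega⟩

/-- On the rows of height 1 mod 4 the second coordinate of `a` changes by even numbers. If i + j is
even, the period is a translation by multiples of 2w and 4q. If i + j is odd, then q must be even
and w odd, so the signs differ and the glide reflection enters. -/
theorem exists_trans_of_rotOrbit_eq (hwq : q % 2 = 1 ∨ (q % 2 = 0 ∧ w % 2 = 1)) {t x y x' y' : ℤ}
    (hy : y % 4 = 1) (hy' : y' % 4 = 1) (h : rotOrbit a t (x, y) = rotOrbit a t (x', y')) :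
    ∃ s j : ℤ, (x' = x + 2 * w * s ∧ y' = y + 4 * q * j) ∨
      (q % 2 = 0 ∧ x' = w - x + 2 * w * s ∧ y' = y + 2 * q + 4 * q * j) := by
  obtain ⟨n, rfl⟩ : ∃ n, y = 4 * n + 1 := ⟨y / 4, by omega⟩
  obtain ⟨n', rfl⟩ : ∃ n', y' = 4 * n' + 1 := ⟨y' / 4, by omega⟩
  have hn : (4 * n + 1 - 1) / 2 = 2 * n := by omega
  have hn' : (4 * n' + 1 - 1) / 2 = 2 * n' := by omega
  -- ε and ε' are the signs that the parities of x and x' produce in `rotOrbit`.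
  have key : ∃ ε ε' i j : ℤ, ((ε = -1 ∧ x % 2 = 0) ∨ (ε = 1 ∧ x % 2 = 1)) ∧
      ((ε' = -1 ∧ x' % 2 = 0) ∨ (ε' = 1 ∧ x' % 2 = 1)) ∧ ε' * x' = ε * x + (i + j) * w ∧
      t - 2 * n' = t - 2 * n + (i - j) * q := by
    rcases Int.emod_two_eq_zero_or_one x with hx | hx <;>
      rcases Int.emod_two_eq_zero_or_one x' with hx' | hx'
    · rw [rotOrbit_one_even t hy hx, rotOrbit_one_even t hy' hx', ha, hn, hn'] at h
      obtain ⟨i, j, h1, h2⟩ := h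
      exact ⟨-1, -1, i, j, by omega, by omega, by linear_combination h1, h2⟩
    · rw [rotOrbit_one_even t hy hx, rotOrbit_one_odd t hy' hx', ha, hn, hn'] at h
      obtain ⟨i, j, h1, h2⟩ := h
      exact ⟨-1, 1, i, j, by omega, by omega, by linear_combination h1, h2⟩
    · rw [rotOrbit_one_odd t hy hx, rotOrbit_one_even t hy' hx', ha, hn, hn'] at h
      obtain ⟨i, j, h1, h2⟩ := h
      exact ⟨1, -1, i, j, by omega, by omega, by linear_combination h1, h2⟩
    · rw [rotOrbit_one_odd t hy hx, rotOrbit_one_odd t hy' hx', ha, hn, hn'] at h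
      obtain ⟨i, j, h1, h2⟩ := h
      exact ⟨1, 1, i, j, by omega, by omega, by linear_combination h1, h2⟩
  obtain ⟨ε, ε', i, j, hε, hε', h1, h2⟩ := key
  rcases Int.even_or_odd' (i + j) with ⟨s, hs | hs⟩
  · obtain rfl : i = 2 * s - j := by omega
    have e1 : (2 * s - j + j) * w = 2 * (s * w) := by ring
    rw [e1] at h1
    rcases hε with ⟨rfl, hx⟩ | ⟨rfl, hx⟩
    · obtain ⟨rfl, -⟩ : ε' = -1 ∧ x' % 2 = 0 := by
        rcases hε' with h | ⟨rfl, h⟩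
        · exact h
        · omega
      exact ⟨-s, j - s, .inl ⟨by linear_combination -h1, by linear_combination -2 * h2⟩⟩
    · obtain ⟨rfl, -⟩ : ε' = 1 ∧ x' % 2 = 1 := by
        rcases hε' with ⟨rfl, h⟩ | h
        · omega
        · exact h
      exact ⟨s, j - s, .inl ⟨by linear_combination h1, by linear_combination -2 * h2⟩⟩
  · obtain rfl : i = 2 * s + 1 - j := by omega
    have e1 : (2 * s + 1 - j + j) * w = 2 * (s * w) + w := by ring
    have e2 : (2 * s + 1 - j - j) * q = 2 * ((s - j) * q) + q := by ring
    rw [e1] at h1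
    rw [e2] at h2
    have hq : q % 2 = 0 := by omega
    have hw : w % 2 = 1 := by omega
    rcases hε with ⟨rfl, hx⟩ | ⟨rfl, hx⟩
    · obtain ⟨rfl, -⟩ : ε' = 1 ∧ x' % 2 = 1 := by
        rcases hε' with ⟨rfl, h⟩ | h
        · omega
        · exact h
      exact ⟨s, j - s - 1, .inr ⟨hq, by linear_combination h1, by linear_combination -2 * h2⟩⟩
    · obtain ⟨rfl, -⟩ : ε' = -1 ∧ x' % 2 = 0 := by
        rcases hε' with h | ⟨rfl, h⟩
        · exact h
        · omega
      exact ⟨-s - 1, j - s - 1, .inr ⟨hq, by linear_combination -h1, by linear_combination -2 * h2⟩⟩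

/-- Vertices with the same image under `rotOrbit` are equivalent under every group which contains
enough symmetries. -/
theorem exists_mem_of_rotOrbit_eq (hwq : q % 2 = 1 ∨ (q % 2 = 0 ∧ w % 2 = 1)) {t : ℤ}
    {H : Subgroup (Equiv.Perm (ℤ × ℤ))} (hrot : tileRot 0 (2 * t) ∈ H)
    (hhor : tileTrans (2 * w) 0 ∈ H) (hver : tileTrans 0 (4 * q) ∈ H)
    (hglide : q % 2 = 0 → tileGlide (2 * q) w ∈ H) {u v : ℤ × ℤ} (hu : u.2 % 2 = 1)
    (hv : v.2 % 2 = 1) (h : rotOrbit a t u = rotOrbit a t v) : ∃ g ∈ H, g u = v := by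
  -- The rotation about (0, 2t) exchanges the heights 1 and 3 mod 4, so both vertices may be taken
  -- at height 1.
  have norm : ∀ u : ℤ × ℤ, u.2 % 2 = 1 → ∃ g ∈ H, (g u).2 % 4 = 1 ∧
      rotOrbit a t (g u) = rotOrbit a t u := by
    intro u hu
    by_cases h4 : u.2 % 4 = 1
    · exact ⟨1, H.one_mem, h4, rfl⟩
    · refine ⟨_, hrot, ?_, rotOrbit_rot_zero t hu⟩
      change (2 * (2 * t) - u.2) % 4 = 1
      omega
  obtain ⟨g, hg, hgu, hu'⟩ := norm u hu
  obtain ⟨k, hk, hkv, hv'⟩ := norm v hv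
  obtain ⟨f, hf, hfe⟩ : ∃ f ∈ H, f (g u) = k v := by
    rw [← hu', ← hv'] at h
    obtain ⟨s, j, ⟨h1, h2⟩ | ⟨hq, h1, h2⟩⟩ := exists_trans_of_rotOrbit_eq ha hwq hgu hkv h
    · exact ⟨_, tileTrans_mem hhor hver s j, Prod.ext h1.symm h2.symm⟩
    · refine ⟨_, H.mul_mem (tileTrans_mem hhor hver s j) (hglide hq), Prod.ext ?_ ?_⟩
      · refine Eq.trans ?_ h1.symm
        change w - (g u).1 + 0 + 2 * w * s = w - (g u).1 + 2 * w * s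
        rw [add_zero]
      · exact h2.symm
  refine ⟨k⁻¹ * (f * g), H.mul_mem (H.inv_mem hk) (H.mul_mem hf hg), ?_⟩
  rw [Equiv.Perm.mul_apply, Equiv.Perm.mul_apply, hfe, ← Equiv.Perm.mul_apply, inv_mul_cancel,
    Equiv.Perm.one_apply]

theorem rotOrbit_kernel_odd (hq : q % 2 = 1) (u v : ℤ × ℤ) (hu : u.2 % 2 = 1) (hv : v.2 % 2 = 1) :
    rotOrbit a 0 u = rotOrbit a 0 v ↔
      ∃ g ∈ Subgroup.closure {tileRot 0 0, tileRot w 0, tileRot 0 (2 * q)}, g u = v := by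
  set S : Set (Equiv.Perm (ℤ × ℤ)) := {tileRot 0 0, tileRot w 0, tileRot 0 (2 * q)} with hS
  have m1 : tileRot 0 0 ∈ Subgroup.closure S := Subgroup.subset_closure (by simp [hS])
  have m2 : tileRot w 0 ∈ Subgroup.closure S := Subgroup.subset_closure (by simp [hS])
  have m3 : tileRot 0 (2 * q) ∈ Subgroup.closure S := Subgroup.subset_closure (by simp [hS])
  constructor
  · refine exists_mem_of_rotOrbit_eq ha (.inl hq) m1 ?_ ?_ (by omega) hu hv
    -- The product of two half-turns is the translation by twice the difference of their centres.
    · convert mul_mem m2 m1 using 1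
      ext v <;> simp [tileTrans, tileRot]
      ring
    · convert mul_mem m3 m1 using 1
      ext v <;> simp [tileTrans, tileRot]
      ring
  · rintro ⟨g, hg, rfl⟩
    refine (closure_invariant ?_ ?_ hg hu).symm
    · rintro g (rfl | rfl | rfl) u <;> simp only [tileRot, Equiv.coe_fn_mk] <;> omega
    · rintro g (rfl | rfl | rfl) u hu
      · exact rotOrbit_rot_zero 0 hu
      · exact rotOrbit_rot_horizontal ha hu
      · simpa using rotOrbit_rot_vertical ha 0 hu

theorem rotOrbit_kernel_even (hq : q % 2 = 0) (hw : w % 2 = 1) (t : ℤ) (u v : ℤ × ℤ)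
    (hu : u.2 % 2 = 1) (hv : v.2 % 2 = 1) : rotOrbit a t u = rotOrbit a t v ↔
      ∃ g ∈ Subgroup.closure
        {tileRot 0 (2 * t), tileRot 0 (2 * t + 2 * q), tileGlide (2 * q) w}, g u = v := by
  set S : Set (Equiv.Perm (ℤ × ℤ)) :=
    {tileRot 0 (2 * t), tileRot 0 (2 * t + 2 * q), tileGlide (2 * q) w} with hS
  have m1 : tileRot 0 (2 * t) ∈ Subgroup.closure S := Subgroup.subset_closure (by simp [hS])
  have m2 : tileRot 0 (2 * t + 2 * q) ∈ Subgroup.closure S :=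
    Subgroup.subset_closure (by simp [hS])
  have m3 : tileGlide (2 * q) w ∈ Subgroup.closure S := Subgroup.subset_closure (by simp [hS])
  constructor
  · refine exists_mem_of_rotOrbit_eq ha (.inr ⟨hq, hw⟩) m1 ?_ ?_ (fun _ => m3) hu hv
    -- The glide reflection times the half-turn is a horizontal glide reflection by w, whose square
    -- is the translation by 2w.
    · convert mul_mem (mul_mem m3 m1) (mul_mem m3 m1) using 1
      ext v <;> simp [tileGlide, tileRefl, tileTrans, tileRot] <;> ring
    · convert mul_mem m2 m1 using 1
      ext v <;> simp [tileTrans, tileRot]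
      ring
  · rintro ⟨g, hg, rfl⟩
    refine (closure_invariant ?_ ?_ hg hu).symm
    · rintro g (rfl | rfl | rfl) ⟨x, y⟩ <;> simp only [tileRot_apply, tileGlide_apply] <;> omega
    · rintro g (rfl | rfl | rfl) u hu
      · exact rotOrbit_rot_zero t hu
      · exact rotOrbit_rot_vertical ha t hu
      · exact rotOrbit_glide ha t hq hw hu

end

/-- The reflection in x = 1/2 exchanges the two classes of y - 2x mod 4, so both vertices may be
taken in class 1, where the value is b (-x). Equality then means that the abscissas differ by a
multiple of 2w. -/
theorem reflOrbit_kernel (hb : ∀ n n', b n = b n' ↔ ∃ i : ℤ, n' = n + 2 * w * i) (u v : ℤ × ℤ)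
    (hu : u.2 % 2 = 1) (hv : v.2 % 2 = 1) : reflOrbit b u = reflOrbit b v ↔
      ∃ g ∈ Subgroup.closure {tileTrans 0 4, tileRefl 1, tileRefl (2 * w + 1)}, g u = v := by
  set S : Set (Equiv.Perm (ℤ × ℤ)) := {tileTrans 0 4, tileRefl 1, tileRefl (2 * w + 1)} with hS
  have m1 : tileTrans 0 4 ∈ Subgroup.closure S := Subgroup.subset_closure (by simp [hS])
  have m2 : tileRefl 1 ∈ Subgroup.closure S := Subgroup.subset_closure (by simp [hS])
  have m3 : tileRefl (2 * w + 1) ∈ Subgroup.closure S := Subgroup.subset_closure (by simp [hS])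
  have m4 : tileTrans (2 * w) 0 ∈ Subgroup.closure S := by
    convert mul_mem m3 m2 using 1
    ext v <;> simp [tileTrans, tileRefl]
    ring
  have hrefl : ∀ u : ℤ × ℤ, u.2 % 2 = 1 → reflOrbit b (tileRefl 1 u) = reflOrbit b u := by
    rintro ⟨x, y⟩ hu
    simp only at hu
    rw [tileRefl_apply]
    have h4 : (y - 2 * x) % 4 = 1 ∨ (y - 2 * x) % 4 = 3 := by omega
    rcases h4 with h4 | h4
    · rw [reflOrbit_pos h4, reflOrbit_neg (by omega)]
      congr 1; ring
    · rw [reflOrbit_neg h4, reflOrbit_pos (by omega)]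
      congr 1; ring
  constructor
  · intro h
    have norm : ∀ u : ℤ × ℤ, u.2 % 2 = 1 → ∃ g ∈ Subgroup.closure S,
        ((g u).2 - 2 * (g u).1) % 4 = 1 ∧ reflOrbit b (g u) = reflOrbit b u := by
      intro u hu
      by_cases h4 : (u.2 - 2 * u.1) % 4 = 1
      · exact ⟨1, one_mem _, h4, rfl⟩
      · refine ⟨_, m2, ?_, hrefl u hu⟩
        change (u.2 - 2 * (1 - u.1)) % 4 = 1
        omega
    obtain ⟨g, hg, hgu, hu'⟩ := norm u hu
    obtain ⟨k, hk, hkv, hv'⟩ := norm v hv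
    obtain ⟨f, hf, hfe⟩ : ∃ f ∈ Subgroup.closure S, f (g u) = k v := by
      rw [← hu', ← hv', reflOrbit_pos hgu, reflOrbit_pos hkv, hb] at h
      obtain ⟨i, hi⟩ := h
      have e : 2 * w * i = 2 * (w * i) := by ring
      rw [e] at hi
      -- The heights differ by a multiple of 4, since y - 2x agrees mod 4 and the abscissas differ
      -- by an even number.
      refine ⟨_, tileTrans_mem m4 m1 (-i) (((k v).2 - (g u).2) / 4), Prod.ext ?_ ?_⟩
      · change (g u).1 + 2 * w * (-i) = (k v).1
        linear_combination hi
      · change (g u).2 + 4 * (((k v).2 - (g u).2) / 4) = (k v).2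
        omega
    refine ⟨k⁻¹ * (f * g), mul_mem (inv_mem hk) (mul_mem hf hg), ?_⟩
    rw [Equiv.Perm.mul_apply, Equiv.Perm.mul_apply, hfe, ← Equiv.Perm.mul_apply, inv_mul_cancel,
      Equiv.Perm.one_apply]
  · rintro ⟨g, hg, rfl⟩
    refine (closure_invariant ?_ ?_ hg hu).symm
    · rintro g (rfl | rfl | rfl) ⟨x, y⟩ <;> simp only [tileRefl_apply, tileTrans_apply]
      omega
    · rintro g (rfl | rfl | rfl) ⟨x, y⟩ hu
      · rw [tileTrans_apply]
        simp only at hu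
        have h4 : (y - 2 * x) % 4 = 1 ∨ (y - 2 * x) % 4 = 3 := by omega
        rcases h4 with h4 | h4
        · rw [reflOrbit_pos h4, reflOrbit_pos (by omega), add_zero]
        · rw [reflOrbit_neg h4, reflOrbit_neg (by omega), add_zero]
      · exact hrefl _ hu
      · rw [tileRefl_apply]
        simp only at hu
        have h4 : (y - 2 * x) % 4 = 1 ∨ (y - 2 * x) % 4 = 3 := by omega
        rcases h4 with h4 | h4
        · rw [reflOrbit_pos h4, reflOrbit_neg (by omega), hb]
          exact ⟨-1, by ring⟩
        · rw [reflOrbit_neg h4, reflOrbit_pos (by omega), hb]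
          exact ⟨1, by ring⟩

end Kernels

/-! ## The components of the Cayley graph -/

namespace IsCoordinates

variable {T : Tangle} {e : ℤ} {a : ℤ → ℤ → (linkDiagram T e).Q₂} {b : ℤ → (linkDiagram T e).Q₂}

theorem a_mem_component
    (h : IsCoordinates (linkGen T e .one) (linkGen T e .two) (linkGen T e .three) a b) (x m : ℤ) :
    (m % 2 = 0 → a x m ∈ (cayleyGraph T e).component (linkGen T e .one)) ∧
      (m % 2 = 1 → a x m ∈ (cayleyGraph T e).component (linkGen T e .three)) := by
  have adj : ∀ {i : Gen} {y z c : (linkDiagram T e).Q₂}, linkGen T e i ◃ y = z →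
      y ∈ (cayleyGraph T e).component c → z ∈ (cayleyGraph T e).component c := fun {i} _ _ _ hy =>
    LabeledGraph.mem_component_of_adj (G := cayleyGraph T e) (l := i) hy
  induction x, m using int_pair_induction with
  | h0 =>
    rw [h.a_zero_zero]
    exact ⟨fun _ => Relation.ReflTransGen.refl, by omega⟩
  | h1 =>
    rw [h.a_zero_one]
    exact ⟨by omega, fun _ => Relation.ReflTransGen.refl⟩
  | s1 x m ih =>
    exact ⟨fun hm => adj (h.one_a x m) (ih.1 (by omega)),
      fun hm => adj (h.one_a x m) (ih.2 (by omega))⟩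
  | s2 x m ih =>
    exact ⟨fun hm => adj (h.two_a x m) (ih.1 hm), fun hm => adj (h.two_a x m) (ih.2 hm)⟩
  | s3 x m ih =>
    exact ⟨fun hm => adj (h.three_a x m) (ih.1 (by omega)),
      fun hm => adj (h.three_a x m) (ih.2 (by omega))⟩

theorem b_mem_component
    (h : IsCoordinates (linkGen T e .one) (linkGen T e .two) (linkGen T e .three) a b) (n : ℤ) :
    b n ∈ (cayleyGraph T e).component (linkGen T e .two) := by
  have adj : ∀ {i : Gen} {y z c : (linkDiagram T e).Q₂}, linkGen T e i ◃ y = z →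
      y ∈ (cayleyGraph T e).component c → z ∈ (cayleyGraph T e).component c := fun {i} _ _ _ hy =>
    LabeledGraph.mem_component_of_adj (G := cayleyGraph T e) (l := i) hy
  induction n using int_reflection_induction with
  | h0 =>
    rw [h.b_zero]
    exact Relation.ReflTransGen.refl
  | s1 n ih => exact adj (h.one_b n) ih
  | s2 n ih => exact adj (h.two_b n) ih

theorem component_two_subset
    (h : IsCoordinates (linkGen T e .one) (linkGen T e .two) (linkGen T e .three) a b) :
    (cayleyGraph T e).component (linkGen T e .two) ⊆ Set.range b := by
  refine LabeledGraph.component_subset (G := cayleyGraph T e) ⟨0, h.b_zero⟩ ?_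
  rintro (_ | _ | _) _ _ rfl ⟨n, rfl⟩
  exacts [⟨_, (h.one_b n).symm⟩, ⟨_, (h.two_b n).symm⟩, ⟨_, (h.three_b n).symm⟩]

theorem component_subset_of_parity
    (h : IsCoordinates (linkGen T e .one) (linkGen T e .two) (linkGen T e .three) a b) {t : ℤ}
    {i : Gen} (hi : a 0 t = linkGen T e i) :
    (cayleyGraph T e).component (linkGen T e i) ⊆ {z | ∃ x j, z = a x (t + 2 * j)} := by
  refine LabeledGraph.component_subset (G := cayleyGraph T e) ⟨0, 0, ?_⟩ ?_
  · rw [mul_zero, add_zero, hi]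
  · rintro (_ | _ | _) _ _ rfl ⟨x, j, rfl⟩
    · refine ⟨-x, -t - j, (h.one_a _ _).trans ?_⟩
      congr 1; ring
    · exact ⟨1 - x, j, h.two_a _ _⟩
    · refine ⟨-x, 1 - t - j, (h.three_a _ _).trans ?_⟩
      congr 1; ring

end IsCoordinates

/-- The reflection m ↦ 1 - m exchanges the formulas for s₁ and s₃, keeps that for s₂, takes x₁ to
x₃, and preserves the periods by exchanging i and j. -/
theorem pointedIso_relabel_swap {T : Tangle} {e w q : ℤ} {a : ℤ → ℤ → (linkDiagram T e).Q₂}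
    {b : ℤ → (linkDiagram T e).Q₂}
    (h : IsCoordinates (linkGen T e .one) (linkGen T e .two) (linkGen T e .three) a b)
    (ha : ∀ x m x' m', a x m = a x' m' ↔
      ∃ i j : ℤ, x' = x + (i + j) * w ∧ m' = m + (i - j) * q) :
    (((cayleyGraph T e).componentGraph (linkGen T e .one)).relabel
        (Equiv.swap Gen.one Gen.three)).PointedIso
      ((cayleyGraph T e).base (linkGen T e .one))
      ((cayleyGraph T e).componentGraph (linkGen T e .three))
      ((cayleyGraph T e).base (linkGen T e .three)) := by
  have hflip : ∀ x m x' m', a x m = a x' m' ↔ a x (1 - m) = a x' (1 - m') := by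
    intro x m x' m'
    rw [ha, ha]
    constructor <;> rintro ⟨i, j, h1, h2⟩ <;>
      exact ⟨j, i, by linear_combination h1, by linear_combination -h2⟩
  have m1 : ∀ u : ℤ × ℤ, a u.1 (2 * u.2) ∈ (cayleyGraph T e).component (linkGen T e .one) :=
    fun u => (h.a_mem_component _ _).1 (by omega)
  have m3 : ∀ u : ℤ × ℤ, a u.1 (1 - 2 * u.2) ∈ (cayleyGraph T e).component (linkGen T e .three) :=
    fun u => (h.a_mem_component _ _).2 (by omega)
  have b1 : (cayleyGraph T e).base (linkGen T e .one) = ⟨a (0, 0).1 (2 * (0, 0).2), m1 (0, 0)⟩ :=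
    Subtype.ext (by simpa using! h.a_zero_zero.symm)
  have b3 : (cayleyGraph T e).base (linkGen T e .three) =
      ⟨a (0, 0).1 (1 - 2 * (0, 0).2), m3 (0, 0)⟩ :=
    Subtype.ext (by simpa using! h.a_zero_one.symm)
  rw [b1, b3]
  refine LabeledGraph.pointedIso_of_surjective
    (G := ((cayleyGraph T e).componentGraph (linkGen T e .one)).relabel
      (Equiv.swap Gen.one Gen.three))
    (H := (cayleyGraph T e).componentGraph (linkGen T e .three))
    (α := fun u : ℤ × ℤ => ⟨a u.1 (2 * u.2), m1 u⟩)
    (β := fun u : ℤ × ℤ => ⟨a u.1 (1 - 2 * u.2), m3 u⟩) ?_ ?_ ?_ ?_ (0, 0)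
  · rintro ⟨z, hz⟩
    obtain ⟨x, j, rfl⟩ := h.component_subset_of_parity h.a_zero_zero hz
    refine ⟨(x, j), Subtype.ext ?_⟩
    change a x (2 * j) = a x (0 + 2 * j)
    rw [zero_add]
  · rintro ⟨z, hz⟩
    obtain ⟨x, j, rfl⟩ := h.component_subset_of_parity h.a_zero_one hz
    refine ⟨(x, -j), Subtype.ext ?_⟩
    change a x (1 - 2 * -j) = a x (1 + 2 * j)
    congr 1; ring
  · intro u v
    exact ⟨fun hh => Subtype.ext ((hflip _ _ _ _).1 (congrArg Subtype.val hh)),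
      fun hh => Subtype.ext ((hflip _ _ _ _).2 (congrArg Subtype.val hh))⟩
  · rintro (_ | _ | _) ⟨x, j⟩ ⟨x', j'⟩
    · change linkGen T e .three ◃ a x (2 * j) = a x' (2 * j') ↔
        linkGen T e .one ◃ a x (1 - 2 * j) = a x' (1 - 2 * j')
      rw [h.three_a, h.one_a, hflip]
      ring_nf
    · change linkGen T e .two ◃ a x (2 * j) = a x' (2 * j') ↔
        linkGen T e .two ◃ a x (1 - 2 * j) = a x' (1 - 2 * j')
      rw [h.two_a, h.two_a, hflip]
    · change linkGen T e .one ◃ a x (2 * j) = a x' (2 * j') ↔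
        linkGen T e .three ◃ a x (1 - 2 * j) = a x' (1 - 2 * j')
      rw [h.one_a, h.three_a, hflip]
      ring_nf

theorem components_eq_of_cover {Λ : Type} {G : LabeledGraph Λ} {ι : Type} (g : ι → G.V)
    (h : ∀ z, ∃ i, z ∈ G.component (g i)) : G.components = Set.range fun i => G.component (g i) := by
  ext C
  constructor
  · rintro ⟨z, rfl⟩
    obtain ⟨i, hi⟩ := h z
    exact ⟨i, (LabeledGraph.component_eq_of_mem hi).symm⟩
  · rintro ⟨i, rfl⟩
    exact ⟨g i, rfl⟩

theorem theorem2 (p q e w : ℤ) (hp : 0 < p) (hpq : p < q) (hcop : IsCoprime p q)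
    (hw : w = (e - 1) * q - p) (T : Tangle) (hT : T.IsRational ((p : ℚ) / q)) :
    (Odd q →
      (cayleyGraph T e).components =
        {(cayleyGraph T e).component (linkGen T e .one),
          (cayleyGraph T e).component (linkGen T e .two)} ∧
      (cayleyGraph T e).component (linkGen T e .one) =
        (cayleyGraph T e).component (linkGen T e .three) ∧
      (cayleyGraph T e).component (linkGen T e .one) ≠
        (cayleyGraph T e).component (linkGen T e .two) ∧
      ComponentIsTileQuotient T e .one {tileRot 0 0, tileRot w 0, tileRot 0 (2 * q)} ∧
      ComponentIsTileQuotient T e .two {tileTrans 0 4, tileRefl 1, tileRefl (2 * w + 1)}) ∧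
    (Even q →
      (cayleyGraph T e).components =
        {(cayleyGraph T e).component (linkGen T e .one),
          (cayleyGraph T e).component (linkGen T e .two),
          (cayleyGraph T e).component (linkGen T e .three)} ∧
      (cayleyGraph T e).component (linkGen T e .one) ≠
        (cayleyGraph T e).component (linkGen T e .two) ∧
      (cayleyGraph T e).component (linkGen T e .one) ≠
        (cayleyGraph T e).component (linkGen T e .three) ∧
      (cayleyGraph T e).component (linkGen T e .two) ≠
        (cayleyGraph T e).component (linkGen T e .three) ∧
      ComponentIsTileQuotient T e .one {tileRot 0 0, tileRot 0 (2 * q), tileGlide (2 * q) w} ∧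
      ComponentIsTileQuotient T e .two {tileTrans 0 4, tileRefl 1, tileRefl (2 * w + 1)} ∧
      ComponentIsTileQuotient T e .three {tileRot 0 2, tileRot 0 (2 + 2 * q), tileGlide (2 * q) w} ∧
      (((cayleyGraph T e).componentGraph (linkGen T e .one)).relabel
          (Equiv.swap Gen.one Gen.three)).PointedIso
        ((cayleyGraph T e).base (linkGen T e .one))
        ((cayleyGraph T e).componentGraph (linkGen T e .three))
        ((cayleyGraph T e).base (linkGen T e .three))) := by
  obtain ⟨a, b, h, surj, ha, hb, hab⟩ := exists_link_coordinates (e := e) (hp.trans hpq) hcop hw hT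
  have hcover : ∀ z : (cayleyGraph T e).V, ∃ i, z ∈ (cayleyGraph T e).component (linkGen T e i) := by
    intro z
    rcases surj z with ⟨x, m, rfl⟩ | ⟨n, rfl⟩
    · rcases Int.emod_two_eq_zero_or_one m with hm | hm
      · exact ⟨.one, (h.a_mem_component x m).1 hm⟩
      · exact ⟨.three, (h.a_mem_component x m).2 hm⟩
    · exact ⟨.two, h.b_mem_component n⟩
  have hcomp := components_eq_of_cover (G := cayleyGraph T e) (linkGen T e) hcover
  have hself : ∀ i, linkGen T e i ∈ (cayleyGraph T e).component (linkGen T e i) := fun i =>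
    Relation.ReflTransGen.refl
  have hne : ∀ t i, a 0 t = linkGen T e i →
      (cayleyGraph T e).component (linkGen T e i) ≠
        (cayleyGraph T e).component (linkGen T e .two) := by
    intro t i hi hC
    have hmem := hself i
    rw [hC] at hmem
    obtain ⟨n, hn⟩ := h.component_two_subset hmem
    exact hab 0 t n (hi.trans hn.symm)
  have h12 := hne 0 .one h.a_zero_zero
  have h32 := hne 1 .three h.a_zero_one
  have htwo : ComponentIsTileQuotient T e .two {tileTrans 0 4, tileRefl 1, tileRefl (2 * w + 1)} :=
    componentIsTileQuotient_of_kernel (θ := reflOrbit b) ((reflOrbit_pos (by norm_num)).trans h.b_zero)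
      (h.reflOrbit_step (x := linkGen T e)) (reflOrbit_kernel hb)
  have base : ∀ t, rotOrbit a t (0, 1) = a 0 t := fun t => by
    rw [rotOrbit_one_even t (by norm_num) (by norm_num)]
    simp
  refine ⟨fun hq => ?_, fun hq => ?_⟩
  · have hq' := Int.odd_iff.1 hq
    have h13 : (cayleyGraph T e).component (linkGen T e .one) =
        (cayleyGraph T e).component (linkGen T e .three) := by
      refine (LabeledGraph.component_eq_of_mem ?_).symm
      -- For odd q the period (w, q) changes the parity of the second index and merges the orbits of
      -- x₁ and x₃.
      have : a 0 1 = a w (1 + q) := (ha _ _ _ _).2 ⟨1, 0, by ring, by ring⟩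
      rw [← h.a_zero_one, this]
      exact (h.a_mem_component _ _).1 (by omega)
    refine ⟨?_, h13, h12, ?_, htwo⟩
    · rw [hcomp]
      ext C
      simp only [Set.mem_range, Set.mem_insert_iff, Set.mem_singleton_iff]
      constructor
      · rintro ⟨_ | _ | _, rfl⟩
        exacts [.inl rfl, .inr rfl, .inl h13.symm]
      · rintro (rfl | rfl)
        exacts [⟨.one, rfl⟩, ⟨.two, rfl⟩]
    · exact componentIsTileQuotient_of_kernel (θ := rotOrbit a 0) ((base 0).trans h.a_zero_zero)
        (h.rotOrbit_step (x := linkGen T e) 0) (rotOrbit_kernel_odd ha hq')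
  · have hq' := Int.even_iff.1 hq
    have hw' : w % 2 = 1 := by
      obtain ⟨α, β, hαβ⟩ := isCoprime_q_w hcop hw
      by_contra hc
      obtain ⟨r, rfl⟩ : ∃ r, q = 2 * r := ⟨q / 2, by omega⟩
      obtain ⟨s, rfl⟩ : ∃ s, w = 2 * s := ⟨w / 2, by omega⟩
      have : 2 * (α * r + β * s) = 1 := by linear_combination hαβ
      omega
    refine ⟨?_, h12, ?_, h32.symm, ?_, htwo, ?_, pointedIso_relabel_swap h ha⟩
    · rw [hcomp]
      ext C
      simp only [Set.mem_range, Set.mem_insert_iff, Set.mem_singleton_iff]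
      constructor
      · rintro ⟨_ | _ | _, rfl⟩
        exacts [.inl rfl, .inr (.inl rfl), .inr (.inr rfl)]
      · rintro (rfl | rfl | rfl)
        exacts [⟨.one, rfl⟩, ⟨.two, rfl⟩, ⟨.three, rfl⟩]
    · intro hC
      have hmem := hself .three
      rw [← hC] at hmem
      obtain ⟨x, j, hx⟩ := h.component_subset_of_parity h.a_zero_zero hmem
      -- For even q every period keeps the parity of the second index, which is 1 for x₃ and even
      -- throughout the component of x₁.
      obtain ⟨i, k, -, h2⟩ := (ha _ _ _ _).1 (h.a_zero_one.trans hx)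
      obtain ⟨r, rfl⟩ : ∃ r, q = 2 * r := ⟨q / 2, by omega⟩
      have : (i - k) * (2 * r) = 2 * ((i - k) * r) := by ring
      omega
    · have := componentIsTileQuotient_of_kernel (θ := rotOrbit a 0) ((base 0).trans h.a_zero_zero)
        (h.rotOrbit_step (x := linkGen T e) 0) (rotOrbit_kernel_even ha hq' hw' 0)
      simpa using this
    · exact componentIsTileQuotient_of_kernel (θ := rotOrbit a 1) ((base 1).trans h.a_zero_one)
        (h.rotOrbit_step (x := linkGen T e) 1) (rotOrbit_kernel_even ha hq' hw' 1)
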